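/- Let $C$ be an origin-symmetric convex body in the coordinate plane $YOZ$ of $\mathbb{R}^3$ (a convex body is a compact convex set with non-empty interior, here relative to the plane; origin-symmetric means $-C=C$), let $a>0$, and let $f:[-a,a]\to[0,\infty)$ be concave and even. Put $v=(1,0,0)$ and suppose that $$K=\bigcup_{x\in[-a,a]}\bigl(f(x)\,C+x\,v\bigr)$$ is a convex body in $\mathbb{R}^3$; such a $K$ is called a parallel sections homothety body. Let $K^{*}=\{x\in\mathbb{R}^3 : x\cdot y\le 1 \text{ for all } y\in K\}$ be its polar body and $\mathcal{P}(K)=\mathrm{Vol}(K)\,\mathrm{Vol}(K^{*})$ its Mahler volume. Then $$\mathcal{P}(K)\ \ge\ \frac{4^3}{3!},$$ and equality holds if and only if $K$ is the image, under an invertible linear map of $\mathbb{R}^3$, of the cube $[-1,1]^3$ or of the octahedron $\{(x_1,x_2,x_3) : |x_1|+|x_2|+|x_3|\le 1\}$. -/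

import Mathlib

open MeasureTheory
open scoped Pointwise Nat

/-- A convex body: a compact convex set with non-empty interior. -/
structure IsConvexBody {n : ℕ} (K : Set (EuclideanSpace ℝ (Fin n))) : Prop where
  convex : Convex ℝ K
  isCompact : IsCompact K
  nonempty_interior : (interior K).Nonempty

/-- The polar body `K* = {x | x · y ≤ 1 for all y ∈ K}`. -/
def polarBody {n : ℕ} (K : Set (EuclideanSpace ℝ (Fin n))) : Set (EuclideanSpace ℝ (Fin n)) :=
  {x | ∀ y ∈ K, inner ℝ x y ≤ 1}

/-- The Mahler volume `P(K) = Vol(K) Vol(K*)`. -/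
noncomputable def mahlerVolume {n : ℕ} (K : Set (EuclideanSpace ℝ (Fin n))) : ℝ :=
  (volume K).toReal * (volume (polarBody K)).toReal

/-- The identification of the plane with the coordinate plane `YOZ` of space. -/
def inPlaneYOZ (p : EuclideanSpace ℝ (Fin 2)) : EuclideanSpace ℝ (Fin 3) :=
  !₂[0, p 0, p 1]

/-- The unit vector in the positive direction of the `X`-axis. -/
def unitX : EuclideanSpace ℝ (Fin 3) := !₂[1, 0, 0]

/-- A parallel sections homothety body: a convex body of the form `⋃_{x ∈ [-a, a]} (f(x) C + x v)`,
where `v = (1, 0, 0)`, `C` is an origin-symmetric convex body in the plane `YOZ`, and `f` is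
concave, even and nonnegative on `[-a, a]`, `a > 0`. -/
def IsParallelSectionsHomothetyBody (K : Set (EuclideanSpace ℝ (Fin 3))) : Prop :=
  IsConvexBody K ∧
    ∃ (a : ℝ) (f : ℝ → ℝ) (C : Set (EuclideanSpace ℝ (Fin 2))),
      0 < a ∧
      ConcaveOn ℝ (Set.Icc (-a) a) f ∧
      (∀ x ∈ Set.Icc (-a) a, f (-x) = f x) ∧
      (∀ x ∈ Set.Icc (-a) a, 0 ≤ f x) ∧
      IsConvexBody C ∧ -C = C ∧
      K = ⋃ x ∈ Set.Icc (-a) a, (f x • (inPlaneYOZ '' C) + {x • unitX})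

/-- The cube `[-1, 1]³`. -/
def stdCube : Set (EuclideanSpace ℝ (Fin 3)) := {x | ∀ i, |x i| ≤ 1}

/-- The regular octahedron `|x₁| + |x₂| + |x₃| ≤ 1`. -/
def stdOctahedron : Set (EuclideanSpace ℝ (Fin 3)) := {x | ∑ i, |x i| ≤ 1}

/-- `K` is, up to an invertible linear transformation, the body `L`. -/
def IsLinearImage (K L : Set (EuclideanSpace ℝ (Fin 3))) : Prop :=
  ∃ T : EuclideanSpace ℝ (Fin 3) ≃ₗ[ℝ] EuclideanSpace ℝ (Fin 3), K = T '' L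

/-! The Mahler volume of a parallel sections homothety body factors. After a linear map, `K` has
sections `ρ(|x|) • C` over `[-1, 1]` with `ρ` concave, nonincreasing and `ρ 0 = 1`; its polar has
the same shape with sections `dualProfile ρ |x| • polarBody C`. Fubini then gives `P(K) = 4
(∫ρ²)(∫ρ*²) P(C)`, integrals over `[0, 1]`, and the bound `32/3 = 4 · (1/3) · 8` splits into a
one-variable inequality and the planar Mahler inequality.

For the profile, let `F, G` be the integrals of `ρ, ρ*` and `A, B` those of their squares. Comparing
areas or volumes with a point `(x, ρ x)` of the graph gives `x + ρ x ≤ 2F` and `x + 2F ρ x ≤ 3A`.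
Hence `(1, 1) / (2F)` and `(1, 2F) / (3A)` lie in the region under `ρ*`, and the same inequalities
for `ρ*` at these points give `FG ≥ 1/2` and `9AB ≥ 1 + 4FG ≥ 3` (`third_le_integral_sq_mul`). In
the case of equality `FG = 1/2`, and polygons inscribed in the two regions force `ρ = 1` or `ρ = 1 -
x` (`eq_one_or_eq_sub`).

For the plane, two lines through the origin cut `C` into four parts of equal area. Equal quarters
bound `C` by a multiple of the parallelogram on the boundary points `±u, ±w`, which puts four
explicit points into the polar; together with the supporting functionals at `u` and `w` they span an
area of at least `8 / Vol(C)` (`eight_le_mahlerVolume`). Equality produces a boundary point with two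
supporting functionals, and the frame built from it shows that `C` is a parallelogram
(`exists_eq_image_of_mahlerVolume_eq`). A parallelogram times a segment is a cube, and a double cone
over it is an octahedron. -/

/-! ### Polar bodies and linear invariance of the Mahler volume -/

section PolarBasics

variable {n : ℕ}

local notation "E" n => EuclideanSpace ℝ (Fin n)

lemma polarBody_eq_iInter (K : Set (E n)) :
    polarBody K = ⋂ y ∈ K, {x | inner ℝ x y ≤ 1} := by
  ext x; simp [polarBody]

lemma convex_polarBody (K : Set (E n)) : Convex ℝ (polarBody K) := by
  intro x hx y hy a b ha hb hab z hz
  have h1 := hx z hz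
  have h2 := hy z hz
  rw [inner_add_left, real_inner_smul_left, real_inner_smul_left]
  nlinarith

lemma isClosed_polarBody (K : Set (E n)) : IsClosed (polarBody K) := by
  rw [polarBody_eq_iInter]
  exact isClosed_biInter fun y _ => isClosed_le (by fun_prop) continuous_const

lemma zero_mem_polarBody (K : Set (E n)) : (0 : E n) ∈ polarBody K := by
  intro y _; simp

lemma neg_mem_polarBody {K : Set (E n)} (hK : -K = K) {x : E n} (hx : x ∈ polarBody K) :
    -x ∈ polarBody K := by
  intro y hy
  have hy' : -y ∈ K := by rw [← hK]; simpa using hy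
  simpa using hx _ hy'

lemma polarBody_polarBody {K : Set (E n)} (hc : Convex ℝ K) (hcl : IsClosed K)
    (h0 : (0 : E n) ∈ K) : polarBody (polarBody K) = K := by
  apply Set.Subset.antisymm
  · intro x hx
    by_contra hxK
    obtain ⟨f, u, hf, hu⟩ := geometric_hahn_banach_closed_point hc hcl hxK
    have hu0 : 0 < u := by simpa using hf 0 h0
    set y := (InnerProductSpace.toDual ℝ (E n)).symm f with hy
    have hyf : ∀ z, inner ℝ y z = f z := fun z => by
      rw [hy, InnerProductSpace.toDual_symm_apply]
    have hm : u⁻¹ • y ∈ polarBody K := by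
      intro z hz
      rw [real_inner_smul_left, hyf, inv_mul_le_iff₀ hu0]
      linarith [hf z hz]
    have := hx _ hm
    rw [real_inner_smul_right, real_inner_comm, hyf, inv_mul_le_iff₀ hu0] at this
    linarith
  · intro x hx y hy
    rw [real_inner_comm]; exact hy x hx

lemma IsConvexBody.neg_mem {K : Set (E n)} (hs : -K = K) {x : E n} (hx : x ∈ K) : -x ∈ K := by
  rw [← hs]; simpa using hx

lemma IsConvexBody.exists_ball {K : Set (E n)} (hK : IsConvexBody K) (hs : -K = K) :
    ∃ r : ℝ, 0 < r ∧ Metric.closedBall (0 : E n) r ⊆ K := by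
  obtain ⟨x, hx⟩ := hK.nonempty_interior
  rw [mem_interior_iff_mem_nhds, Metric.nhds_basis_closedBall.mem_iff] at hx
  obtain ⟨r, hr, h⟩ := hx
  refine ⟨r, hr, fun y hy => ?_⟩
  have hy' : ‖y‖ ≤ r := by simpa using hy
  have h1 : x + y ∈ K := h (by simpa using hy')
  have h2 : -(x - y) ∈ K := IsConvexBody.neg_mem hs (h (by simpa [dist_eq_norm] using hy'))
  have := hK.convex h1 h2 (by norm_num : (0:ℝ) ≤ 1/2) (by norm_num : (0:ℝ) ≤ 1/2) (by norm_num)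
  convert this using 1
  module

lemma IsConvexBody.zero_mem {K : Set (E n)} (hK : IsConvexBody K) (hs : -K = K) :
    (0 : E n) ∈ K := by
  obtain ⟨r, hr, h⟩ := hK.exists_ball hs
  exact h (by simpa using hr.le)

lemma IsConvexBody.smul_mem {K : Set (E n)} (hK : IsConvexBody K) (hs : -K = K) {x : E n}
    (hx : x ∈ K) {t : ℝ} (ht : |t| ≤ 1) : t • x ∈ K := by
  have hx' := IsConvexBody.neg_mem hs hx
  rw [abs_le] at ht
  have := hK.convex hx hx' (by linarith : (0:ℝ) ≤ (1+t)/2) (by linarith : (0:ℝ) ≤ (1-t)/2) (by ring)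
  convert this using 1
  module

lemma IsConvexBody.polarBody {K : Set (E n)} (hK : IsConvexBody K) (hs : -K = K) :
    IsConvexBody (polarBody K) := by
  refine ⟨convex_polarBody K, ?_, ?_⟩
  · obtain ⟨r, hr, h⟩ := hK.exists_ball hs
    refine Metric.isCompact_of_isClosed_isBounded (isClosed_polarBody K) ?_
    refine (Metric.isBounded_closedBall (x := (0 : E n)) (r := r⁻¹)).subset fun x hx => ?_
    rw [mem_closedBall_zero_iff]
    rcases eq_or_ne x 0 with rfl | hx0
    · simpa using hr.le
    have hn : 0 < ‖x‖ := norm_pos_iff.2 hx0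
    have hm : (r * ‖x‖⁻¹) • x ∈ K := by
      apply h
      rw [mem_closedBall_zero_iff, norm_smul, Real.norm_eq_abs, abs_of_pos (by positivity)]
      field_simp; rfl
    have := hx _ hm
    rw [real_inner_smul_right, real_inner_self_eq_norm_sq] at this
    rw [le_inv_comm₀ hn hr, inv_eq_one_div, le_div_iff₀ hn]
    field_simp at this
    linarith
  · obtain ⟨R, hR0, hR⟩ := hK.isCompact.isBounded.exists_pos_norm_le
    refine ⟨0, ?_⟩
    rw [mem_interior_iff_mem_nhds, Metric.nhds_basis_closedBall.mem_iff]
    refine ⟨R⁻¹, by positivity, fun x hx y hy => ?_⟩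
    rw [mem_closedBall_zero_iff] at hx
    calc inner ℝ x y ≤ ‖x‖ * ‖y‖ := real_inner_le_norm x y
      _ ≤ R⁻¹ * R := by gcongr; exact hR y hy
      _ = 1 := by field_simp

lemma neg_polarBody {K : Set (E n)} (hs : -K = K) : -polarBody K = polarBody K := by
  ext x
  exact ⟨fun h => by simpa using neg_mem_polarBody hs h, fun h => neg_mem_polarBody hs h⟩

lemma IsConvexBody.volume_lt_top {K : Set (E n)} (hK : IsConvexBody K) : volume K < ⊤ :=
  hK.isCompact.measure_lt_top

lemma IsConvexBody.volume_pos {K : Set (E n)} (hK : IsConvexBody K) : 0 < (volume K).toReal :=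
  ENNReal.toReal_pos (Measure.measure_pos_of_nonempty_interior _ hK.nonempty_interior).ne'
    hK.volume_lt_top.ne

lemma polarBody_image (T : (E n) ≃ₗ[ℝ] (E n)) (K : Set (E n)) :
    polarBody (T '' K) = (LinearMap.adjoint (T : (E n) →ₗ[ℝ] (E n))) ⁻¹' polarBody K := by
  ext x
  simp [polarBody, LinearMap.adjoint_inner_left]

lemma det_adjoint_real (T : (E n) →ₗ[ℝ] (E n)) :
    LinearMap.det (LinearMap.adjoint T) = LinearMap.det T := by
  have b := stdOrthonormalBasis ℝ (E n)
  rw [← LinearMap.det_toMatrix b.toBasis, ← LinearMap.det_toMatrix b.toBasis T,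
    LinearMap.toMatrix_adjoint, Matrix.det_conjTranspose]
  simp

/-- The polar transforms by the inverse adjoint, so the two determinant factors cancel. -/
lemma mahlerVolume_image (T : (E n) ≃ₗ[ℝ] (E n)) (K : Set (E n)) :
    mahlerVolume (T '' K) = mahlerVolume K := by
  have hd : LinearMap.det (T : (E n) →ₗ[ℝ] (E n)) ≠ 0 := T.isUnit_det'.ne_zero
  rw [mahlerVolume, mahlerVolume, polarBody_image, Measure.addHaar_preimage_linearMap,
    det_adjoint_real]
  · have := Measure.addHaar_image_linearMap volume (T : (E n) →ₗ[ℝ] (E n)) K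
    rw [LinearEquiv.coe_coe] at this
    rw [this, ENNReal.toReal_mul, ENNReal.toReal_mul, ENNReal.toReal_ofReal (abs_nonneg _),
      ENNReal.toReal_ofReal (abs_nonneg _), abs_inv]
    have := abs_pos.2 hd
    field_simp
  · rwa [det_adjoint_real]

/-- In every direction `w`, a symmetric convex body has a boundary point with a supporting
functional. -/
lemma exists_boundary_support {K : Set (E n)} (hK : IsConvexBody K) (hs : -K = K) {w : E n}
    (hw : w ≠ 0) : ∃ β : ℝ, 0 < β ∧ β • w ∈ K ∧ ∃ q ∈ polarBody K, inner ℝ q (β • w) = (1 : ℝ) := by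
  have hP := hK.polarBody hs
  -- The functional in the polar body that is largest on `w` is the supporting one; `β` is the
  -- inverse of the maximum, and the bipolar theorem puts `β • w` in `K`.
  obtain ⟨q, hq, hmax⟩ := hP.isCompact.exists_isMaxOn ⟨0, zero_mem_polarBody K⟩
    (f := fun q => inner ℝ q w) (by fun_prop)
  obtain ⟨r, hr, hrK⟩ := hP.exists_ball (neg_polarBody hs)
  have hn : 0 < ‖w‖ := norm_pos_iff.2 hw
  have hpos : 0 < inner ℝ q w := by
    have hm : (r * ‖w‖⁻¹) • w ∈ polarBody K := by
      apply hrK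
      rw [mem_closedBall_zero_iff, norm_smul, Real.norm_eq_abs, abs_of_pos (by positivity)]
      field_simp; rfl
    have h1 : inner ℝ ((r * ‖w‖⁻¹) • w) w ≤ inner ℝ q w := hmax hm
    rw [real_inner_smul_left, real_inner_self_eq_norm_sq] at h1
    refine lt_of_lt_of_le ?_ h1
    positivity
  refine ⟨(inner ℝ q w)⁻¹, by positivity, ?_, q, hq, ?_⟩
  · rw [← polarBody_polarBody hK.convex hK.isCompact.isClosed (hK.zero_mem hs)]
    intro y hy
    rw [real_inner_smul_left, inv_mul_le_iff₀ hpos, real_inner_comm, mul_one]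
    exact hmax hy
  · rw [real_inner_smul_right]; field_simp

end PolarBasics

/-! ### The one-variable inequality for a profile and its dual -/

/-- A concave nonincreasing nonnegative function on `[0, 1]` with value `1` at `0`. -/
structure IsProfile (f : ℝ → ℝ) : Prop where
  concave : ConcaveOn ℝ (Set.Icc 0 1) f
  antitone : AntitoneOn f (Set.Icc 0 1)
  map_zero : f 0 = 1
  nonneg : ∀ x ∈ Set.Icc (0 : ℝ) 1, 0 ≤ f x

/-- The profile of the polar body of a body with profile `f`. -/
noncomputable def dualProfile (f : ℝ → ℝ) (s : ℝ) : ℝ :=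
  sSup {r | 0 ≤ r ∧ ∀ x ∈ Set.Icc (0 : ℝ) 1, s * x + r * f x ≤ 1}

lemma ConcaveOn.trapezoid_le_integral {h : ℝ → ℝ} {α β : ℝ} (hαβ : α ≤ β)
    (hc : ConcaveOn ℝ (Set.Icc α β) h) (hi : IntervalIntegrable h volume α β) :
    (β - α) * (h α + h β) / 2 ≤ ∫ x in α..β, h x := by
  rcases hαβ.eq_or_lt with rfl | hlt
  · simp
  have hd : 0 < β - α := sub_pos.2 hlt
  set c := (h β - h α) / (β - α) with hcdef
  have hcc : c * (β - α) = h β - h α := by rw [hcdef]; field_simp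
  have h1 : ∫ x in α..β, (h α + c * (x - α)) = (β - α) * (h α + h β) / 2 := by
    rw [intervalIntegral.integral_add (by simp) (by apply Continuous.intervalIntegrable; fun_prop),
      intervalIntegral.integral_const_mul, intervalIntegral.integral_sub (by simp) (by simp)]
    simp only [intervalIntegral.integral_const, integral_id, smul_eq_mul]
    linear_combination (β - α) / 2 * hcc
  rw [← h1]
  apply intervalIntegral.integral_mono_on hαβ (by apply Continuous.intervalIntegrable; fun_prop) hi
  intro x hx
  have hm := hc.2 (Set.left_mem_Icc.2 hαβ) (Set.right_mem_Icc.2 hαβ)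
    (div_nonneg (sub_nonneg.2 hx.2) hd.le) (div_nonneg (sub_nonneg.2 hx.1) hd.le)
    (by field_simp; ring)
  simp only [smul_eq_mul] at hm
  have e1 : (β - x) / (β - α) * α + (x - α) / (β - α) * β = x := by field_simp; ring
  have e2 : (β - x) / (β - α) * h α + (x - α) / (β - α) * h β = h α + c * (x - α) := by
    rw [hcdef]; field_simp; ring
  rw [e1, e2] at hm
  exact hm

namespace IsProfile

variable {f : ℝ → ℝ} (hf : IsProfile f)
include hf

lemma le_one {x : ℝ} (hx : x ∈ Set.Icc (0 : ℝ) 1) : f x ≤ 1 :=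
  hf.map_zero ▸ hf.antitone (by simp) hx hx.1

lemma intervalIntegrable {α β : ℝ} (h0 : 0 ≤ α) (h : α ≤ β) (h1 : β ≤ 1) :
    IntervalIntegrable f volume α β := by
  apply AntitoneOn.intervalIntegrable
  rw [Set.uIcc_of_le h]
  exact hf.antitone.mono (Set.Icc_subset_Icc h0 h1)

lemma intervalIntegrable_sq {α β : ℝ} (h0 : 0 ≤ α) (h : α ≤ β) (h1 : β ≤ 1) :
    IntervalIntegrable (fun x => f x ^ 2) volume α β := by
  apply AntitoneOn.intervalIntegrable
  rw [Set.uIcc_of_le h]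
  intro x hx y hy hxy
  have hx' := Set.Icc_subset_Icc h0 h1 hx
  have hy' := Set.Icc_subset_Icc h0 h1 hy
  have := hf.antitone hx' hy' hxy
  have := hf.nonneg y hy'
  simp only
  gcongr

lemma trapezoid {α β : ℝ} (h0 : 0 ≤ α) (h : α ≤ β) (h1 : β ≤ 1) :
    (β - α) * (f α + f β) / 2 ≤ ∫ x in α..β, f x :=
  (hf.concave.subset (Set.Icc_subset_Icc h0 h1) (convex_Icc _ _)).trapezoid_le_integral h
    (hf.intervalIntegrable h0 h h1)

/-- The region under the graph contains the quadrilateral `(0,0), (0,1), (x, f x), (1,0)`, of area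
`(x + f x) / 2`. -/
lemma add_le_two_mul_integral {x : ℝ} (hx : x ∈ Set.Icc (0 : ℝ) 1) :
    x + f x ≤ 2 * ∫ t in (0 : ℝ)..1, f t := by
  have h1 := hf.trapezoid le_rfl hx.1 hx.2
  have h2 := hf.trapezoid hx.1 hx.2 le_rfl
  rw [← intervalIntegral.integral_add_adjacent_intervals
    (hf.intervalIntegrable le_rfl hx.1 hx.2) (hf.intervalIntegrable hx.1 hx.2 le_rfl)]
  have h3 := hf.nonneg 1 (by simp)
  rw [hf.map_zero] at h1
  nlinarith [mul_nonneg (sub_nonneg.2 hx.2) h3]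

/-- Contract the graph by the ratio `1 - l` towards `(x, f x)`. By concavity the image stays below
the graph; it lives over `[l x, l x + 1 - l]`. Add the part of `∫ f²` to the left of this interval
and drop the part to its right. -/
lemma integral_sq_contract {x : ℝ} (hx : x ∈ Set.Icc (0 : ℝ) 1) {l : ℝ} (hl0 : 0 < l)
    (hl1 : l < 1) :
    (x + 2 * f x * ∫ t in (0 : ℝ)..1, f t) * (1 - l) ^ 2 ≤
      (∫ t in (0 : ℝ)..1, f t ^ 2) * (3 - 3 * l + l ^ 2) := by
  set A := ∫ t in (0 : ℝ)..1, f t ^ 2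
  set F := ∫ t in (0 : ℝ)..1, f t
  have hfx := hf.nonneg x hx
  have hlx0 : 0 ≤ l * x := mul_nonneg hl0.le hx.1
  have hlx : l * x ≤ l := by nlinarith [hx.2]
  have hb : l * x + (1 - l) ≤ 1 := by linarith
  have hsplit : A = (∫ t in (0 : ℝ)..(l * x), f t ^ 2) +
      (∫ t in (l * x)..(l * x + (1 - l)), f t ^ 2) + ∫ t in (l * x + (1 - l))..1, f t ^ 2 := by
    rw [intervalIntegral.integral_add_adjacent_intervals
      (hf.intervalIntegrable_sq le_rfl hlx0 (by linarith))
      (hf.intervalIntegrable_sq hlx0 (by linarith) hb),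
      intervalIntegral.integral_add_adjacent_intervals
      (hf.intervalIntegrable_sq le_rfl (by linarith) hb)
      (hf.intervalIntegrable_sq (by linarith) hb le_rfl)]
  have h3 : 0 ≤ ∫ t in (l * x + (1 - l))..1, f t ^ 2 :=
    intervalIntegral.integral_nonneg hb fun t _ => sq_nonneg _
  -- To the left of the contracted copy, `f t ≥ f (l x) ≥ (1 - l) f 0 + l f x ≥ 1 - l`.
  have h1 : l * x * (1 - l) ^ 2 ≤ ∫ t in (0 : ℝ)..(l * x), f t ^ 2 := by
    have : ∫ t in (0 : ℝ)..(l * x), (1 - l) ^ 2 = l * x * (1 - l) ^ 2 := by simp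
    rw [← this]
    apply intervalIntegral.integral_mono_on hlx0 (by simp)
      (hf.intervalIntegrable_sq le_rfl hlx0 (by linarith))
    intro t ht
    have a1 := hf.antitone ⟨ht.1, by linarith [ht.2]⟩ ⟨hlx0, by linarith⟩ ht.2
    have a2 := hf.concave.2 (by simp : (0 : ℝ) ∈ Set.Icc (0 : ℝ) 1) hx (sub_nonneg.2 hl1.le) hl0.le
      (by ring)
    simp only [smul_eq_mul, mul_zero, zero_add, hf.map_zero, mul_one] at a2
    have : 1 - l ≤ f t := by nlinarith
    have : 0 ≤ 1 - l := by linarith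
    gcongr
  have h2 : (1 - l) * ((1 - l) ^ 2 * A + 2 * l * (1 - l) * f x * F) ≤
      ∫ t in (l * x)..(l * x + (1 - l)), f t ^ 2 := by
    have hsub := intervalIntegral.smul_integral_comp_mul_add (a := 0) (b := 1)
      (fun t => f t ^ 2) (1 - l) (l * x)
    rw [mul_zero, zero_add, mul_one, add_comm (1 - l)] at hsub
    rw [← hsub, smul_eq_mul]
    apply mul_le_mul_of_nonneg_left _ (by linarith)
    have hI : (1 - l) ^ 2 * A + 2 * l * (1 - l) * f x * F =
        ∫ t in (0 : ℝ)..1, ((1 - l) ^ 2 * f t ^ 2 + 2 * l * (1 - l) * f x * f t) := by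
      rw [intervalIntegral.integral_add
        ((hf.intervalIntegrable_sq le_rfl zero_le_one le_rfl).const_mul _)
        ((hf.intervalIntegrable le_rfl zero_le_one le_rfl).const_mul _),
        intervalIntegral.integral_const_mul, intervalIntegral.integral_const_mul]
    have hmem : ∀ t ∈ Set.Icc (0 : ℝ) 1, (1 - l) * t + l * x ∈ Set.Icc (0 : ℝ) 1 := by
      intro t ht
      constructor
      · nlinarith [ht.1]
      · nlinarith [ht.2]
    rw [hI]
    apply intervalIntegral.integral_mono_on zero_le_one
    · exact ((hf.intervalIntegrable_sq le_rfl zero_le_one le_rfl).const_mul _).add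
        ((hf.intervalIntegrable le_rfl zero_le_one le_rfl).const_mul _)
    · apply AntitoneOn.intervalIntegrable
      rw [Set.uIcc_of_le zero_le_one]
      intro s hs t ht hst
      have := hf.antitone (hmem s hs) (hmem t ht) (by nlinarith)
      have := hf.nonneg _ (hmem t ht)
      simp only
      gcongr
    · intro t ht
      have a2 := hf.concave.2 ht hx (sub_nonneg.2 hl1.le) hl0.le (by ring)
      simp only [smul_eq_mul] at a2
      have hft := hf.nonneg t ht
      have : ((1 - l) * f t + l * f x) ^ 2 ≤ f ((1 - l) * t + l * x) ^ 2 := by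
        have : 0 ≤ (1 - l) * f t + l * f x := by
          have : 0 ≤ 1 - l := by linarith
          positivity
        gcongr
      nlinarith [sq_nonneg (l * f x)]
  -- The copy contributes `(1 - l)³ A`, and `1 - (1 - l)³ = l (3 - 3l + l²)`, so a factor `l` can be
  -- cancelled.
  have key : l * ((x + 2 * f x * F) * (1 - l) ^ 2) ≤ l * (A * (3 - 3 * l + l ^ 2)) := by
    nlinarith
  exact le_of_mul_le_mul_left key hl0

/-- The limit `l → 0` of the contraction inequality. -/
lemma add_le_three_mul_integral_sq {x : ℝ} (hx : x ∈ Set.Icc (0 : ℝ) 1) :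
    x + 2 * f x * (∫ t in (0 : ℝ)..1, f t) ≤ 3 * ∫ t in (0 : ℝ)..1, f t ^ 2 := by
  set A := ∫ t in (0 : ℝ)..1, f t ^ 2
  set F := ∫ t in (0 : ℝ)..1, f t
  have h1 : Filter.Tendsto (fun l : ℝ => (x + 2 * f x * F) * (1 - l) ^ 2)
      (nhdsWithin 0 (Set.Ioi 0)) (nhds ((x + 2 * f x * F) * (1 - 0) ^ 2)) :=
    (Continuous.tendsto (by fun_prop) _).mono_left nhdsWithin_le_nhds
  have h2 : Filter.Tendsto (fun l : ℝ => A * (3 - 3 * l + l ^ 2))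
      (nhdsWithin 0 (Set.Ioi 0)) (nhds (A * (3 - 3 * 0 + 0 ^ 2))) :=
    (Continuous.tendsto (by fun_prop) _).mono_left nhdsWithin_le_nhds
  have := le_of_tendsto_of_tendsto h1 h2 (by
    filter_upwards [Ioo_mem_nhdsGT (zero_lt_one' ℝ)] with l hl
    exact hf.integral_sq_contract hx hl.1 hl.2)
  linarith

lemma dual_bddAbove (s : ℝ) :
    BddAbove {r | 0 ≤ r ∧ ∀ x ∈ Set.Icc (0 : ℝ) 1, s * x + r * f x ≤ 1} := by
  refine ⟨1, fun r hr => ?_⟩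
  have := hr.2 0 (by simp)
  rw [hf.map_zero] at this
  linarith

lemma le_dual {s r : ℝ} (hr : 0 ≤ r) (h : ∀ x ∈ Set.Icc (0 : ℝ) 1, s * x + r * f x ≤ 1) :
    r ≤ dualProfile f s :=
  le_csSup (hf.dual_bddAbove s) ⟨hr, h⟩

lemma dual_feasible {s : ℝ} (hs : s ∈ Set.Icc (0 : ℝ) 1) {x : ℝ} (hx : x ∈ Set.Icc (0 : ℝ) 1) :
    s * x + dualProfile f s * f x ≤ 1 := by
  have hsx : s * x ≤ 1 := by nlinarith [hs.1, hs.2, hx.1, hx.2]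
  rcases (hf.nonneg x hx).eq_or_lt with h0 | h0
  · rw [← h0]; linarith
  have : dualProfile f s ≤ (1 - s * x) / f x := by
    apply csSup_le
    · exact ⟨0, le_rfl, fun y hy => by nlinarith [hs.1, hs.2, hy.1, hy.2]⟩
    · intro r hr
      rw [le_div_iff₀ h0]
      linarith [hr.2 x hx]
  rw [le_div_iff₀ h0] at this
  linarith

lemma dual_nonneg {s : ℝ} (hs : s ∈ Set.Icc (0 : ℝ) 1) : 0 ≤ dualProfile f s :=
  hf.le_dual le_rfl fun x hx => by nlinarith [hs.1, hs.2, hx.1, hx.2]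

lemma dual : IsProfile (dualProfile f) := by
  refine ⟨⟨convex_Icc _ _, ?_⟩, ?_, ?_, fun s hs => hf.dual_nonneg hs⟩
  · intro s hs t ht a b ha hb hab
    apply hf.le_dual
    · have := hf.dual_nonneg hs
      have := hf.dual_nonneg ht
      simp only [smul_eq_mul]; positivity
    · intro x hx
      have h1 := hf.dual_feasible hs hx
      have h2 := hf.dual_feasible ht hx
      simp only [smul_eq_mul]
      nlinarith
  · intro s hs t ht hst
    apply hf.le_dual (hf.dual_nonneg ht)
    intro x hx
    have := hf.dual_feasible ht hx
    nlinarith [hx.1]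
  · apply le_antisymm
    · have := hf.dual_feasible (s := 0) (by simp) (x := 0) (by simp)
      rw [hf.map_zero] at this
      linarith
    · apply hf.le_dual zero_le_one
      intro x hx
      linarith [hf.le_one hx]

lemma half_le_integral : 1 / 2 ≤ ∫ t in (0 : ℝ)..1, f t := by
  have := hf.add_le_two_mul_integral (x := 0) (by simp)
  rw [hf.map_zero] at this
  linarith

lemma third_le_integral_sq : 1 / 3 ≤ ∫ t in (0 : ℝ)..1, f t ^ 2 := by
  have := hf.add_le_three_mul_integral_sq (x := 0) (by simp)
  rw [hf.map_zero] at this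
  linarith [hf.half_le_integral]

lemma inv_two_integral_le_dual : 1 / (2 * ∫ t in (0 : ℝ)..1, f t) ≤
    dualProfile f (1 / (2 * ∫ t in (0 : ℝ)..1, f t)) := by
  have hF := hf.half_le_integral
  apply hf.le_dual (by positivity)
  intro x hx
  have := hf.add_le_two_mul_integral hx
  have h0 : 0 < 2 * ∫ t in (0 : ℝ)..1, f t := by linarith
  rw [← mul_add, one_div, inv_mul_le_iff₀ h0, mul_one]
  exact this

lemma inv_two_integral_mem : 1 / (2 * ∫ t in (0 : ℝ)..1, f t) ∈ Set.Icc (0 : ℝ) 1 := by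
  have hF := hf.half_le_integral
  refine ⟨by positivity, ?_⟩
  rw [div_le_one (by linarith)]
  linarith

/-- The linear inequality for the dual profile is applied at its point `(1, 1) / (2F)`. -/
lemma half_le_integral_mul :
    1 / 2 ≤ (∫ t in (0 : ℝ)..1, f t) * ∫ t in (0 : ℝ)..1, dualProfile f t := by
  have h1 := hf.inv_two_integral_le_dual
  have h2 := hf.dual.add_le_two_mul_integral hf.inv_two_integral_mem
  have hF := hf.half_le_integral
  set F := ∫ t in (0 : ℝ)..1, f t
  have : 1 / (2 * F) * F = 1 / 2 := by field_simp
  nlinarith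

/-- The quadratic inequality for `f` says that `(1, 2F) / (3A)` lies under the dual graph; the
quadratic inequality for the dual profile at this point gives the claim after multiplication by
`3A`. -/
lemma integral_sq_mul_ge :
    1 + 4 * ((∫ t in (0 : ℝ)..1, f t) * ∫ t in (0 : ℝ)..1, dualProfile f t) ≤
      9 * ((∫ t in (0 : ℝ)..1, f t ^ 2) * ∫ t in (0 : ℝ)..1, dualProfile f t ^ 2) := by
  have hF := hf.half_le_integral
  have hA := hf.third_le_integral_sq
  have hG := hf.dual.half_le_integral
  have hle := fun x hx => hf.add_le_three_mul_integral_sq (x := x) hx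
  have hmem : 1 / (3 * ∫ t in (0 : ℝ)..1, f t ^ 2) ∈ Set.Icc (0 : ℝ) 1 := by
    refine ⟨by positivity, ?_⟩
    rw [div_le_one (by linarith)]
    linarith
  have h2 := hf.dual.add_le_three_mul_integral_sq hmem
  set A := ∫ t in (0 : ℝ)..1, f t ^ 2
  set F := ∫ t in (0 : ℝ)..1, f t
  set G := ∫ t in (0 : ℝ)..1, dualProfile f t
  set B := ∫ t in (0 : ℝ)..1, dualProfile f t ^ 2
  have h1 : 2 * F / (3 * A) ≤ dualProfile f (1 / (3 * A)) := by
    apply hf.le_dual (by positivity)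
    intro x hx
    have e : 1 / (3 * A) * x + 2 * F / (3 * A) * f x = (x + 2 * f x * F) / (3 * A) := by ring
    rw [e, div_le_one (by linarith)]
    exact hle x hx
  have h3 : 1 / (3 * A) + 2 * (2 * F / (3 * A)) * G ≤ 3 * B := by nlinarith
  have h4 := mul_le_mul_of_nonneg_left h3 (by linarith : 0 ≤ 3 * A)
  have e : 3 * A * (1 / (3 * A) + 2 * (2 * F / (3 * A)) * G) = 1 + 4 * (F * G) := by
    field_simp; ring
  rw [e] at h4
  linarith

theorem third_le_integral_sq_mul :
    1 / 3 ≤ (∫ t in (0 : ℝ)..1, f t ^ 2) * ∫ t in (0 : ℝ)..1, dualProfile f t ^ 2 := by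
  linarith [hf.half_le_integral_mul, hf.integral_sq_mul_ge]

/-- By the shoelace formula the left side is twice the area of the polygon `(0,0), (0,1), (p,q),
(s,r), (1,0)`. -/
lemma polygon_le_two_mul_integral {s r : ℝ} (hs : s ∈ Set.Icc (0 : ℝ) 1) (hr : r ≤ f s) {p q : ℝ}
    (hp0 : 0 ≤ p) (hps : p ≤ s) (hq : q ≤ f p) :
    p + (s * q - p * r) + r ≤ 2 * ∫ t in (0 : ℝ)..1, f t := by
  have hp : p ≤ 1 := hps.trans hs.2
  have h1 := hf.trapezoid le_rfl hp0 hp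
  have h2 := hf.trapezoid hp0 hps hs.2
  have h3 := hf.trapezoid hs.1 hs.2 le_rfl
  rw [← intervalIntegral.integral_add_adjacent_intervals
    (hf.intervalIntegrable le_rfl hs.1 hs.2) (hf.intervalIntegrable hs.1 hs.2 le_rfl),
    ← intervalIntegral.integral_add_adjacent_intervals
    (hf.intervalIntegrable le_rfl hp0 hp) (hf.intervalIntegrable hp0 hps hs.2)]
  have h4 := hf.nonneg 1 (by simp)
  rw [hf.map_zero] at h1
  nlinarith [mul_nonneg (sub_nonneg.2 hs.2) h4, mul_nonneg (sub_nonneg.2 hp) (sub_nonneg.2 hr),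
    mul_nonneg hs.1 (sub_nonneg.2 hq)]

/-- Equality forces `FG = 1/2`, so the quadrilateral with vertices `(0,0), (0,1), (G,G), (1,0)`
fills the dual region. Dually, the vertices `(2F - 1, 1)` and `(1, 2F - 1)` are on the graph of `f`.
Continuity makes the maxima below attained and excludes a jump at `1`, which the integrals do not
see. -/
lemma eq_one_or_eq_sub (hcont : ContinuousOn f (Set.Icc 0 1))
    (h : (∫ t in (0 : ℝ)..1, f t ^ 2) * (∫ t in (0 : ℝ)..1, dualProfile f t ^ 2) = 1 / 3) :
    (∀ x ∈ Set.Icc (0 : ℝ) 1, f x = 1) ∨ ∀ x ∈ Set.Icc (0 : ℝ) 1, f x = 1 - x := by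
  have hge := hf.integral_sq_mul_ge
  rw [h] at hge
  have hFG := hf.half_le_integral_mul
  have hF := hf.half_le_integral
  have hG := hf.dual.half_le_integral
  have hgG := hf.inv_two_integral_le_dual
  have hGmem := hf.inv_two_integral_mem
  have hfF := fun x hx => hf.add_le_two_mul_integral (x := x) hx
  have hpoly := fun s hs r hr p q => hf.polygon_le_two_mul_integral (s := s) hs (r := r) hr (p := p)
    (q := q)
  have hpolyd := fun s hs r hr p q => hf.dual.polygon_le_two_mul_integral (s := s) hs (r := r) hr
    (p := p) (q := q)
  set F := ∫ t in (0 : ℝ)..1, f t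
  set G := ∫ t in (0 : ℝ)..1, dualProfile f t
  have hFG' : F * G = 1 / 2 := by linarith
  have hGF : 1 / (2 * F) = G := by field_simp; linarith
  rw [hGF] at hgG hGmem
  have hGx : ∀ x ∈ Set.Icc (0 : ℝ) 1, G * x + G * f x ≤ 1 := fun x hx => by nlinarith [hfF x hx]
  have h2F : ∀ y, G * y = 1 → y = 2 * F := fun y hy => by
    have : G * (y - 2 * F) = 0 := by linarith
    rcases mul_eq_zero.1 this with h | h <;> linarith
  -- the point `(2 * F - 1, 1)` is on the graph
  have hv1 : 2 * F - 1 ∈ Set.Icc (0 : ℝ) 1 ∧ f (2 * F - 1) = 1 := by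
    -- The functional is the midpoint of the dual edge from `(0, 1)` to `(G, G)`. Divided by its
    -- maximum `M` it lies in the dual region; if `M < 1` it would stick out of the edge and the
    -- polygon area would exceed `G`. So `M ≥ 1`, and then `G (x + f x) ≤ 1` and `f x ≤ 1` are both
    -- equalities.
    obtain ⟨x, hx, hmax⟩ := isCompact_Icc.exists_isMaxOn (Set.nonempty_Icc.2 zero_le_one)
      (f := fun x => G / 2 * x + (1 + G) / 2 * f x) (by fun_prop)
    set M := G / 2 * x + (1 + G) / 2 * f x with hM
    have hle : ∀ y ∈ Set.Icc (0 : ℝ) 1, G / 2 * y + (1 + G) / 2 * f y ≤ M := fun y hy => hmax hy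
    have h0 := hle 0 (by simp)
    rw [hf.map_zero] at h0
    have hMpos : 0 < M := by linarith
    have hsM : G / 2 / M ≤ G := by rw [div_le_iff₀ hMpos]; nlinarith
    have hq : (1 + G) / 2 / M ≤ dualProfile f (G / 2 / M) := by
      apply hf.le_dual (by positivity)
      intro y hy
      have e : G / 2 / M * y + (1 + G) / 2 / M * f y = (G / 2 * y + (1 + G) / 2 * f y) / M := by
        ring
      rw [e, div_le_one hMpos]
      exact hle y hy
    have hp := hpolyd G hGmem G hgG _ _ (by positivity) hsM hq
    have e : G / 2 / M + (G * ((1 + G) / 2 / M) - G / 2 / M * G) + G = G / M + G := by ring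
    rw [e] at hp
    have h3 : G / M ≤ G := by linarith
    rw [div_le_iff₀ hMpos] at h3
    have hM1 : 1 ≤ M := by nlinarith
    have h4 := hGx x hx
    have h5 := hf.le_one hx
    have h6 : f x = 1 := by linarith
    have h7 := h2F (x + f x) (by linarith)
    have h8 : x = 2 * F - 1 := by linarith
    rw [← h8]
    exact ⟨hx, h6⟩
  -- the point `(1, 2 * F - 1)` is on the graph
  have hv2 : f 1 = 2 * F - 1 := by
    -- The same with the midpoint of the other dual edge, from `(G, G)` to `(1, 0)`.
    obtain ⟨x, hx, hmax⟩ := isCompact_Icc.exists_isMaxOn (Set.nonempty_Icc.2 zero_le_one)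
      (f := fun x => (1 + G) / 2 * x + G / 2 * f x) (by fun_prop)
    set M := (1 + G) / 2 * x + G / 2 * f x with hM
    have hle : ∀ y ∈ Set.Icc (0 : ℝ) 1, (1 + G) / 2 * y + G / 2 * f y ≤ M := fun y hy => hmax hy
    have h0 := hle 1 (by simp)
    have hf1 := hf.nonneg 1 (by simp)
    have hMpos : 0 < M := by nlinarith
    have h4 := hGx x hx
    have hMle : M ≤ 1 := by linarith [hx.2]
    have hsM : G ≤ (1 + G) / 2 / M := by
      rw [le_div_iff₀ hMpos]; nlinarith [hGmem.2]
    have hs1 : (1 + G) / 2 / M ≤ 1 := by rw [div_le_one hMpos]; nlinarith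
    have hq : G / 2 / M ≤ dualProfile f ((1 + G) / 2 / M) := by
      apply hf.le_dual (by positivity)
      intro y hy
      have e : (1 + G) / 2 / M * y + G / 2 / M * f y = ((1 + G) / 2 * y + G / 2 * f y) / M := by
        ring
      rw [e, div_le_one hMpos]
      exact hle y hy
    have hp := hpolyd _ ⟨by positivity, hs1⟩ _ hq G G hGmem.1 hsM hgG
    have e : G + ((1 + G) / 2 / M * G - G * (G / 2 / M)) + G / 2 / M = G / M + G := by ring
    rw [e] at hp
    have h3 : G / M ≤ G := by linarith
    rw [div_le_iff₀ hMpos] at h3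
    have hM1 : 1 ≤ M := by nlinarith
    have h6 : x = 1 := by linarith [hx.2]
    have h7 := h2F (x + f x) (by linarith)
    rw [h6] at h7
    linarith
  -- With `v = 2F - 1`, the polygon through `(v, 1)` and `(1, v)` gives `v (1 - v) ≤ 0`, so `v` is
  -- `0` or `1`.
  have hp := hpoly 1 (by simp) _ hv2.ge _ _ hv1.1.1 hv1.1.2 hv1.2.ge
  have hv : (2 * F - 1) * (1 - (2 * F - 1)) ≤ 0 := by nlinarith
  rcases eq_or_lt_of_le hv1.1.2 with h1 | h1
  · left
    intro x hx
    apply le_antisymm (hf.le_one hx)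
    have := hf.antitone hx (by simp : (1 : ℝ) ∈ Set.Icc (0 : ℝ) 1) hx.2
    linarith
  · right
    have h0 : 2 * F - 1 = 0 := by nlinarith [hv1.1.1]
    intro x hx
    have h2 := hfF x hx
    have h3 := hf.concave.2 (by simp : (0 : ℝ) ∈ Set.Icc (0 : ℝ) 1)
      (by simp : (1 : ℝ) ∈ Set.Icc (0 : ℝ) 1) (sub_nonneg.2 hx.2) hx.1 (by ring)
    simp only [smul_eq_mul, mul_zero, zero_add, mul_one, hf.map_zero] at h3
    have := hf.nonneg 1 (by simp)
    nlinarith [hx.1]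

end IsProfile

/-! ### Areas of planar convex sets in cones, and bisection -/

section PlanarCones

local notation "E₂" => EuclideanSpace ℝ (Fin 2)

/-- The determinant of two vectors of the plane. -/
def cross (u w : EuclideanSpace ℝ (Fin 2)) : ℝ := u 0 * w 1 - u 1 * w 0

/-- The open cone of directions met when turning counterclockwise from `u` to `w`. -/
def openCone (u w : EuclideanSpace ℝ (Fin 2)) : Set (EuclideanSpace ℝ (Fin 2)) :=
  {x | 0 < cross u x ∧ 0 < cross x w}

/-- The linear map sending the standard basis to `u`, `w`. -/
def planeMap (u w : EuclideanSpace ℝ (Fin 2)) :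
    EuclideanSpace ℝ (Fin 2) →ₗ[ℝ] EuclideanSpace ℝ (Fin 2) where
  toFun x := x 0 • u + x 1 • w
  map_add' x y := by simp; module
  map_smul' r x := by simp; module

lemma planeMap_apply (u w x : E₂) : planeMap u w x = x 0 • u + x 1 • w := rfl

lemma det_planeMap (u w : E₂) : LinearMap.det (planeMap u w) = cross u w := by
  rw [← LinearMap.det_toMatrix (EuclideanSpace.basisFun (Fin 2) ℝ).toBasis, Matrix.det_fin_two]
  simp [LinearMap.toMatrix_apply, planeMap_apply, cross]
  ring

lemma continuous_cross_left (w : E₂) : Continuous fun x => cross x w := by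
  unfold cross; fun_prop

lemma continuous_cross_right (u : E₂) : Continuous fun x => cross u x := by
  unfold cross; fun_prop

lemma measurableSet_openCone (u w : E₂) : MeasurableSet (openCone u w) :=
  ((isOpen_lt continuous_const (continuous_cross_right u)).inter
    (isOpen_lt continuous_const (continuous_cross_left w))).measurableSet

lemma eq_smul_add_smul {u w : E₂} (h : cross u w ≠ 0) (x : E₂) :
    x = (cross x w / cross u w) • u + (cross u x / cross u w) • w := by
  ext i
  fin_cases i
  · simp; field_simp; simp [cross]; ring
  · simp; field_simp; simp [cross]; ring

lemma volume_standardTriangle :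
    volume {x : E₂ | 0 < x 0 ∧ 0 < x 1 ∧ x 0 + x 1 < 1} = ENNReal.ofReal (1 / 2) := by
  have hreg : volume (regionBetween (fun _ => (0 : ℝ)) (fun x => 1 - x) (Set.Ioo (0 : ℝ) 1)) =
      ENNReal.ofReal (1 / 2) := by
    rw [Measure.volume_eq_prod, volume_regionBetween_eq_integral]
    · congr 1
      simp only [Pi.sub_apply, sub_zero]
      rw [← integral_Ioc_eq_integral_Ioo, ← intervalIntegral.integral_of_le zero_le_one,
        intervalIntegral.integral_sub (by simp) (by simp)]
      simp; norm_num
    · simp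
    · exact (Continuous.integrableOn_Icc (by fun_prop)).mono_set Set.Ioo_subset_Icc_self
    · exact measurableSet_Ioo
    · intro x hx
      simp; exact hx.2.le
  have hmp := (volume_preserving_finTwoArrow ℝ).comp (PiLp.volume_preserving_ofLp (Fin 2))
  rw [← hreg, ← hmp.measure_preimage (measurableSet_regionBetween measurable_const
    (by fun_prop) measurableSet_Ioo).nullMeasurableSet]
  congr 1
  ext x
  simp only [Set.mem_ofPred_eq, regionBetween, Set.mem_preimage, Function.comp, Set.mem_Ioo,
    MeasurableEquiv.finTwoArrow_apply]
  constructor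
  · rintro ⟨h0, h1, h2⟩
    exact ⟨⟨h0, by linarith⟩, h1, by linarith⟩
  · rintro ⟨⟨h0, h1⟩, h2, h3⟩
    exact ⟨h0, h2, by linarith⟩

lemma triangle_le_volume {K : Set E₂} (hK : Convex ℝ K) (hfin : volume K ≠ ⊤) (h0 : (0 : E₂) ∈ K)
    {u w : E₂} (hu : u ∈ K) (hw : w ∈ K) :
    cross u w / 2 ≤ volume.real (K ∩ openCone u w) := by
  rcases le_or_gt (cross u w) 0 with hle | hpos
  · have : 0 ≤ volume.real (K ∩ openCone u w) := measureReal_nonneg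
    linarith
  have hsub : planeMap u w '' {x : E₂ | 0 < x 0 ∧ 0 < x 1 ∧ x 0 + x 1 < 1} ⊆
      K ∩ openCone u w := by
    rintro _ ⟨x, ⟨hx0, hx1, hx2⟩, rfl⟩
    refine ⟨?_, ?_, ?_⟩
    · have := hK.sum_mem (t := Finset.univ) (w := ![1 - x 0 - x 1, x 0, x 1]) (z := ![0, u, w])
        (by intro i _; fin_cases i <;> simp <;> linarith) (by simp [Fin.sum_univ_three]; ring)
        (by intro i _; fin_cases i <;> simpa)
      simpa [Fin.sum_univ_three, planeMap_apply] using this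
    · have : cross u (planeMap u w x) = x 1 * cross u w := by
        simp [cross, planeMap_apply]; ring
      rw [this]; positivity
    · have : cross (planeMap u w x) w = x 0 * cross u w := by
        simp [cross, planeMap_apply]; ring
      rw [this]; positivity
  have hm := measureReal_mono hsub (measure_ne_top_of_subset Set.inter_subset_left hfin)
  refine le_trans (le_of_eq ?_) hm
  rw [Measure.real, Measure.addHaar_image_linearMap, det_planeMap, volume_standardTriangle,
    ← ENNReal.ofReal_mul (abs_nonneg _), ENNReal.toReal_ofReal (by positivity), abs_of_pos hpos]
  ring

/-- The Plücker relation: it decides the sign of a third cross product when a cone is split. -/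
lemma cross_mul_cross (u p w x : E₂) :
    cross x w * cross u p = cross u x * cross p w + cross x p * cross u w := by
  simp [cross]; ring

lemma cross_swap (u w : E₂) : cross w u = -cross u w := by
  simp [cross]; ring

lemma cross_same (u : E₂) : cross u u = 0 := by
  simp [cross]; ring

/-- Splitting a cone along a direction that it contains. -/
lemma volume_openCone_add_le {S : Set E₂} (hS : MeasurableSet S) (hfin : volume S ≠ ⊤) {u p w : E₂}
    (huw : 0 < cross u w) (hup : 0 ≤ cross u p) (hpw : 0 ≤ cross p w) :
    volume.real (S ∩ openCone u p) + volume.real (S ∩ openCone p w) ≤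
      volume.real (S ∩ openCone u w) := by
  have hd : Disjoint (S ∩ openCone u p) (S ∩ openCone p w) := by
    rw [Set.disjoint_left]
    rintro x ⟨_, _, h1⟩ ⟨_, h2, _⟩
    rw [cross_swap] at h1
    linarith
  rw [← measureReal_union hd (hS.inter (measurableSet_openCone p w))
    (measure_ne_top_of_subset Set.inter_subset_left hfin)
    (measure_ne_top_of_subset Set.inter_subset_left hfin)]
  apply measureReal_mono _ (measure_ne_top_of_subset Set.inter_subset_left hfin)
  rintro x (⟨hx, h1, h2⟩ | ⟨hx, h1, h2⟩)
  · refine ⟨hx, h1, ?_⟩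
    have := cross_mul_cross u p w x
    by_contra! hneg
    nlinarith [mul_pos h2 huw, mul_nonneg h1.le hpw]
  · refine ⟨hx, ?_, h2⟩
    have := cross_mul_cross u p w x
    rw [cross_swap p x] at this
    by_contra! hneg
    nlinarith [mul_pos h1 huw, mul_nonneg h2.le hup]

/-- A convex set containing `0`, `u`, `w`, `a • u + b • w` has at least the area of the
quadrilateral with these vertices in the cone spanned by `u` and `w`. -/
lemma quadrilateral_le_volume {K : Set E₂} (hK : Convex ℝ K) (hKm : MeasurableSet K)
    (hfin : volume K ≠ ⊤) (h0 : (0 : E₂) ∈ K) {u w : E₂} (hu : u ∈ K) (hw : w ∈ K)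
    (huw : 0 < cross u w) {a b : ℝ}
    (ha : 0 ≤ a) (hb : 0 ≤ b) (hp : a • u + b • w ∈ K) :
    cross u w * (a + b) / 2 ≤ volume.real (K ∩ openCone u w) := by
  have h1 : cross u (a • u + b • w) = b * cross u w := by simp [cross]; ring
  have h2 : cross (a • u + b • w) w = a * cross u w := by simp [cross]; ring
  have h3 := volume_openCone_add_le hKm hfin huw (p := a • u + b • w) (by rw [h1]; positivity)
    (by rw [h2]; positivity)
  have h4 := triangle_le_volume hK hfin h0 hu hp
  have h5 := triangle_le_volume hK hfin h0 hp hw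
  rw [h1] at h4
  rw [h2] at h5
  linarith

/-- The two cones are disjoint in the half plane to the left of `u`, and by symmetry this half plane
holds as much of `K` as the opposite one. The inequality suffices, so the boundary rays can be
ignored. -/
lemma two_mul_volume_openCone_add_le {K : Set E₂} (hs : -K = K) (hKm : MeasurableSet K)
    (hfin : volume K ≠ ⊤) (u w : E₂) :
    2 * (volume.real (K ∩ openCone u w) + volume.real (K ∩ openCone w (-u))) ≤
      volume.real K := by
  have hne : ∀ s : Set E₂, volume (K ∩ s) ≠ ⊤ := fun s =>
    measure_ne_top_of_subset Set.inter_subset_left hfin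
  have hmeas : MeasurableSet {x | 0 < cross u x} :=
    (isOpen_lt continuous_const (continuous_cross_right u)).measurableSet
  have hmeas' : MeasurableSet {x | cross u x < 0} :=
    (isOpen_lt (continuous_cross_right u) continuous_const).measurableSet
  have hneg : volume.real (K ∩ {x | cross u x < 0}) = volume.real (K ∩ {x | 0 < cross u x}) := by
    have : K ∩ {x | cross u x < 0} = -(K ∩ {x | 0 < cross u x}) := by
      rw [Set.inter_neg, hs]
      congr 1
      ext x
      simp only [cross, Set.mem_ofPred_eq, Set.mem_neg, PiLp.neg_apply]
      constructor <;> intro h <;> linarith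
    rw [this, Measure.real, Measure.measure_neg, Measure.real]
  have h1 : volume.real (K ∩ openCone u w) + volume.real (K ∩ openCone w (-u)) ≤
      volume.real (K ∩ {x | 0 < cross u x}) := by
    rw [← measureReal_union _ (hKm.inter (measurableSet_openCone _ _)) (hne _) (hne _)]
    · apply measureReal_mono _ (hne _)
      rintro x (⟨hx, h1, h2⟩ | ⟨hx, h1, h2⟩)
      · exact ⟨hx, h1⟩
      · refine ⟨hx, ?_⟩
        simp only [cross, PiLp.neg_apply] at h2
        simp only [Set.mem_ofPred_eq, cross]
        linarith
    · rw [Set.disjoint_left]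
      rintro x ⟨_, _, h1⟩ ⟨_, h2, _⟩
      rw [cross_swap] at h1
      linarith
  have h2 : volume.real (K ∩ {x | 0 < cross u x}) + volume.real (K ∩ {x | cross u x < 0}) ≤
      volume.real K := by
    rw [← measureReal_union _ (hKm.inter hmeas') (hne _) (hne _)]
    · exact measureReal_mono (by
        rintro x (⟨hx, _⟩ | ⟨hx, _⟩) <;> exact hx) hfin
    · rw [Set.disjoint_left]
      rintro x ⟨_, h1⟩ ⟨_, h2⟩
      simp only [Set.mem_ofPred_eq] at h1 h2
      linarith
  linarith

lemma volume_cross_eq_zero {w : E₂} (hw : w ≠ 0) : volume {x : E₂ | cross x w = 0} = 0 := by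
  let L : E₂ →ₗ[ℝ] ℝ :=
    { toFun := fun x => cross x w
      map_add' := fun x y => by simp [cross]; ring
      map_smul' := fun r x => by simp [cross]; ring }
  have hL : LinearMap.ker L ≠ ⊤ := by
    intro h
    have h1 : !₂[w 1, -w 0] ∈ LinearMap.ker L := h ▸ Submodule.mem_top
    have h2 : cross !₂[w 1, -w 0] w = 0 := h1
    simp only [cross, Matrix.cons_val_zero, Matrix.cons_val_one] at h2
    apply hw
    ext i
    fin_cases i
    · simp; nlinarith [sq_nonneg (w 0), sq_nonneg (w 1)]
    · simp; nlinarith [sq_nonneg (w 0), sq_nonneg (w 1)]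
  exact Measure.addHaar_submodule volume _ hL

open ProbabilityTheory Filter in
-- The jump of the distribution function at `t` is the mass of `{t}`.
lemma continuous_cdf_of_noAtoms (ν : Measure ℝ) [IsProbabilityMeasure ν]
    (hν : ∀ t, ν {t} = 0) : Continuous (cdf ν) := by
  rw [continuous_iff_continuousAt]
  intro t
  rw [(monotone_cdf ν).continuousAt_iff_leftLim_eq_rightLim, StieltjesFunction.rightLim_eq]
  have h := (cdf ν).measure_singleton t
  rw [measure_cdf, hν, eq_comm, ENNReal.ofReal_eq_zero] at h
  exact le_antisymm ((monotone_cdf ν).leftLim_le le_rfl) (by linarith)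

/-- Every direction `u` admits a direction `w` bisecting the half plane to the left of `u`. -/
lemma exists_bisecting {K : Set E₂} (hKm : MeasurableSet K) (hfin : volume K ≠ ⊤) {u : E₂}
    (hu : u ≠ 0) : ∃ w, 0 < cross u w ∧
      volume.real (K ∩ openCone u w) = volume.real (K ∩ openCone w (-u)) := by
  -- `W t` is the quarter turn of `u` plus `t • u`; up to scaling these are all directions strictly
  -- to the left of `u`. In the half plane, being on one side of `W t` means comparing the slope `g
  -- x` with `t`, so bisection asks for a median of `g`.
  let W : ℝ → E₂ := fun t => !₂[t * u 0 - u 1, t * u 1 + u 0]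
  let N : E₂ → ℝ := fun x => x 0 * u 0 + x 1 * u 1
  have hu0 : 0 < u 0 ^ 2 + u 1 ^ 2 := by
    by_contra! h
    apply hu
    ext i
    fin_cases i
    · simp; nlinarith [sq_nonneg (u 0), sq_nonneg (u 1)]
    · simp; nlinarith [sq_nonneg (u 0), sq_nonneg (u 1)]
  have hW : ∀ t, cross u (W t) = u 0 ^ 2 + u 1 ^ 2 := fun t => by simp [cross, W]; ring
  have hW' : ∀ t x, cross x (W t) = N x - t * cross u x := fun t x => by
    simp [cross, W, N]; ring
  have hWne : ∀ t, W t ≠ 0 := fun t h => by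
    have := hW t
    rw [h] at this
    simp [cross] at this
    linarith
  set H := K ∩ {x | 0 < cross u x} with hH
  have hHm : MeasurableSet H :=
    hKm.inter (isOpen_lt continuous_const (continuous_cross_right u)).measurableSet
  have hHfin : volume H ≠ ⊤ := measure_ne_top_of_subset Set.inter_subset_left hfin
  let g : E₂ → ℝ := fun x => N x / cross u x
  have hg : Measurable g := by
    apply Measurable.div
    · exact Continuous.measurable (by fun_prop)
    · exact (continuous_cross_right u).measurable
  have h1 : ∀ t, K ∩ openCone u (W t) = H ∩ g ⁻¹' Set.Ioi t := by
    intro t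
    ext x
    simp only [openCone, hW', hH, Set.mem_inter_iff, Set.mem_ofPred_eq, Set.mem_preimage,
      Set.mem_Ioi, and_assoc]
    refine and_congr_right fun _ => and_congr_right fun hx => ?_
    rw [lt_div_iff₀ hx, sub_pos]
  have h2 : ∀ t, K ∩ openCone (W t) (-u) = H ∩ g ⁻¹' Set.Iio t := by
    intro t
    ext x
    have e : cross x (-u) = cross u x := by simp [cross]; ring
    simp only [openCone, cross_swap x (W t), hW', e, hH, Set.mem_inter_iff, Set.mem_ofPred_eq,
      Set.mem_preimage, Set.mem_Iio]
    constructor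
    · rintro ⟨a, b, c⟩
      refine ⟨⟨a, c⟩, ?_⟩
      rw [div_lt_iff₀ c]; linarith
    · rintro ⟨⟨a, c⟩, b⟩
      rw [div_lt_iff₀ c] at b
      exact ⟨a, by linarith, c⟩
  suffices h : ∃ t, volume (H ∩ g ⁻¹' Set.Ioi t) = volume (H ∩ g ⁻¹' Set.Iio t) by
    obtain ⟨t, ht⟩ := h
    exact ⟨W t, by rw [hW]; exact hu0, by rw [h1, h2, Measure.real, ht, Measure.real]⟩
  have hnull : ∀ t, volume (H ∩ g ⁻¹' {t}) = 0 := by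
    intro t
    refine measure_mono_null ?_ (volume_cross_eq_zero (hWne t))
    rintro x ⟨⟨_, hx⟩, hxt⟩
    simp only [Set.mem_preimage, Set.mem_singleton_iff, Set.mem_ofPred_eq] at hx hxt ⊢
    rw [hW', ← hxt]
    simp only [g]
    field_simp
    ring
  rcases eq_or_ne (volume H) 0 with hz | hz
  · exact ⟨0, by rw [measure_mono_null Set.inter_subset_left hz,
      measure_mono_null Set.inter_subset_left hz]⟩
  have := ProbabilityTheory.cond_isProbabilityMeasure_of_finite hz hHfin
  set ν := (ProbabilityTheory.cond volume H).map g
  have hprob : IsProbabilityMeasure ν := Measure.isProbabilityMeasure_map hg.aemeasurable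
  have hν : ∀ s, MeasurableSet s → ν s = (volume H)⁻¹ * volume (H ∩ g ⁻¹' s) := fun s hsm => by
    rw [Measure.map_apply hg hsm, ProbabilityTheory.cond_apply hHm]
  have hat : ∀ t, ν {t} = 0 := fun t => by rw [hν _ (measurableSet_singleton t), hnull, mul_zero]
  obtain ⟨t, ht⟩ : ∃ t, ProbabilityTheory.cdf ν t = 1 / 2 := by
    refine mem_range_of_exists_le_of_exists_ge (continuous_cdf_of_noAtoms ν hat) ?_ ?_
    · exact ((ProbabilityTheory.tendsto_cdf_atBot ν).eventually_le_const
        (by norm_num : (0 : ℝ) < 1 / 2)).exists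
    · exact ((ProbabilityTheory.tendsto_cdf_atTop ν).eventually_const_le
        (by norm_num : (1 / 2 : ℝ) < 1)).exists
  refine ⟨t, ?_⟩
  rw [ProbabilityTheory.cdf_eq_real] at ht
  have hIoi : ν (Set.Ioi t) = ν (Set.Iic t) := by
    rw [← Set.compl_Iic, ← ENNReal.toReal_eq_toReal_iff' (measure_ne_top _ _) (measure_ne_top _ _)]
    have := probReal_compl_eq_one_sub (μ := ν) (measurableSet_Iic (a := t))
    change ν.real _ = ν.real _
    rw [this, ht]
    norm_num
  have hIic : ν (Set.Iic t) = ν (Set.Iio t) := by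
    apply le_antisymm _ (measure_mono Set.Iio_subset_Iic_self)
    rw [← Set.Iio_union_right]
    refine (measure_union_le _ _).trans ?_
    rw [hat, add_zero]
  rw [hIic, hν _ measurableSet_Ioi, hν _ measurableSet_Iio] at hIoi
  exact (ENNReal.mul_right_inj (ENNReal.inv_ne_zero.2 hHfin) (ENNReal.inv_ne_top.2 hz)).1 hIoi

end PlanarCones

/-! ### The planar Mahler inequality and its equality case -/

section PlanarMahler

local notation "E₂" => EuclideanSpace ℝ (Fin 2)

/-- The vector with inner products `a` and `b` with `u` and `w`. -/
noncomputable def dualVector (u w : EuclideanSpace ℝ (Fin 2)) (a b : ℝ) :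
    EuclideanSpace ℝ (Fin 2) :=
  !₂[(a * w 1 - b * u 1) / cross u w, (b * u 0 - a * w 0) / cross u w]

lemma inner_plane (x y : E₂) : inner ℝ x y = x 0 * y 0 + x 1 * y 1 := by
  simp [PiLp.inner_apply, Fin.sum_univ_two]; ring

lemma inner_dualVector_left {u w : E₂} (h : cross u w ≠ 0) (a b : ℝ) :
    inner ℝ (dualVector u w a b) u = a := by
  rw [inner_plane]; simp [dualVector]; field_simp; simp [cross]; ring

lemma inner_dualVector_right {u w : E₂} (h : cross u w ≠ 0) (a b : ℝ) :
    inner ℝ (dualVector u w a b) w = b := by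
  rw [inner_plane]; simp [dualVector]; field_simp; simp [cross]; ring

lemma eq_dualVector {u w : E₂} (h : cross u w ≠ 0) (p : E₂) :
    p = dualVector u w (inner ℝ p u) (inner ℝ p w) := by
  simp only [inner_plane]
  ext i
  fin_cases i
  · simp [dualVector]; field_simp; simp [cross]; ring
  · simp [dualVector]; field_simp; simp [cross]; ring

lemma cross_dualVector {u w : E₂} (h : cross u w ≠ 0) (a b c d : ℝ) :
    cross (dualVector u w a b) (dualVector u w c d) = (a * d - b * c) / cross u w := by
  have key : ∀ D : ℝ, D ≠ 0 → u 0 * w 1 - u 1 * w 0 = D →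
      (a * w 1 - b * u 1) / D * ((d * u 0 - c * w 0) / D) -
        (b * u 0 - a * w 0) / D * ((c * w 1 - d * u 1) / D) = (a * d - b * c) / D := by
    intro D hD e
    field_simp
    rw [← e]
    ring
  exact key _ h rfl

lemma smul_dualVector_add (u w : E₂) (r s a b c d : ℝ) :
    r • dualVector u w a b + s • dualVector u w c d =
      dualVector u w (r * a + s * c) (r * b + s * d) := by
  ext i
  fin_cases i
  · simp [dualVector]; ring
  · simp [dualVector]; ring

lemma neg_dualVector (u w : E₂) (a b : ℝ) : -dualVector u w a b = dualVector u w (-a) (-b) := by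
  ext i
  fin_cases i
  · simp [dualVector]; ring
  · simp [dualVector]; ring

/-- Two boundary points `u`, `w` of `K` with supporting functionals `p`, `q`, such that the lines
through them cut `K` into four parts of equal area. -/
structure IsBisectingFrame (K : Set (EuclideanSpace ℝ (Fin 2)))
    (u w p q : EuclideanSpace ℝ (Fin 2)) : Prop where
  left_mem : u ∈ K
  right_mem : w ∈ K
  cross_pos : 0 < cross u w
  left_support : p ∈ polarBody K
  inner_left : inner ℝ p u = (1 : ℝ)
  right_support : q ∈ polarBody K
  inner_right : inner ℝ q w = (1 : ℝ)
  area_first : volume.real (K ∩ openCone u w) ≤ volume.real K / 4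
  area_second : volume.real (K ∩ openCone w (-u)) ≤ volume.real K / 4

variable {K : Set (EuclideanSpace ℝ (Fin 2))}

/-- The bisecting direction is rescaled to reach the boundary of `K`, which does not change the
cones. -/
lemma exists_isBisectingFrame (hK : IsConvexBody K) (hs : -K = K) {u p : E₂} (hu : u ∈ K)
    (hp : p ∈ polarBody K) (hpu : inner ℝ p u = (1 : ℝ)) :
    ∃ w q, IsBisectingFrame K u w p q := by
  have hu0 : u ≠ 0 := by rintro rfl; simp at hpu
  have hKm := hK.isCompact.isClosed.measurableSet
  obtain ⟨w, hw, hvol⟩ := exists_bisecting hKm hK.volume_lt_top.ne hu0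
  have hw0 : w ≠ 0 := by rintro rfl; simp [cross] at hw
  have hsum := two_mul_volume_openCone_add_le hs hKm hK.volume_lt_top.ne u w
  obtain ⟨β, hβ, hβK, q, hq, hqw⟩ := exists_boundary_support hK hs hw0
  have c1 : openCone u (β • w) = openCone u w := by
    ext x
    have : cross x (β • w) = β * cross x w := by simp [cross]; ring
    simp [openCone, this, hβ]
  have c2 : openCone (β • w) (-u) = openCone w (-u) := by
    ext x
    have : cross (β • w) x = β * cross w x := by simp [cross]; ring
    simp [openCone, this, hβ]
  refine ⟨β • w, q, hu, hβK, ?_, hp, hpu, hq, hqw, ?_, ?_⟩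
  · have : cross u (β • w) = β * cross u w := by simp [cross]; ring
    rw [this]; positivity
  · rw [c1]; linarith
  · rw [c2]; linarith

namespace IsBisectingFrame

variable {u w p q : EuclideanSpace ℝ (Fin 2)} (hK : IsConvexBody K) (hs : -K = K)
  (hF : IsBisectingFrame K u w p q)
include hK hs hF

/-- For `a, b ≥ 0` the quadrilateral `0, u, a • u + b • w, w` has area `cross u w * (a + b) / 2` and
fits into a quarter of area at most `Vol(K) / 4`. The other signs use the adjacent quarter and
central symmetry. -/
lemma abs_add_abs_le {a b : ℝ} (h : a • u + b • w ∈ K) :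
    |a| + |b| ≤ volume.real K / (2 * cross u w) := by
  have hd := hF.cross_pos
  have hKm := hK.isCompact.isClosed.measurableSet
  wlog hb : 0 ≤ b generalizing a b
  · have := this (a := -a) (b := -b) (by
      have := IsConvexBody.neg_mem hs h
      convert this using 1; module) (by linarith)
    simpa using this
  rw [le_div_iff₀ (by positivity), abs_of_nonneg hb]
  rcases le_total 0 a with ha | ha
  · have := quadrilateral_le_volume hK.convex hKm hK.volume_lt_top.ne (hK.zero_mem hs)
      hF.left_mem hF.right_mem hd ha hb h
    rw [abs_of_nonneg ha]
    linarith [hF.area_first]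
  · have hd' : cross w (-u) = cross u w := by simp [cross]; ring
    have := quadrilateral_le_volume hK.convex hKm hK.volume_lt_top.ne (hK.zero_mem hs)
      hF.right_mem (IsConvexBody.neg_mem hs hF.left_mem) (by rw [hd']; exact hd) hb
      (neg_nonneg.2 ha) (by convert h using 1; module)
    rw [abs_of_nonpos ha]
    rw [hd'] at this
    linarith [hF.area_second]

/-- Dual form of `abs_add_abs_le`: `K` lies in a multiple of the parallelogram with vertices `±u,
±w`, so its polar contains the vertices of the dual parallelogram. -/
lemma dualVector_mem {σ : ℝ} (hσ : |σ| = 1) :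
    dualVector u w (2 * cross u w / volume.real K) (σ * (2 * cross u w / volume.real K)) ∈
      polarBody K := by
  intro y hy
  have hd := hF.cross_pos
  have hV : 0 < volume.real K := hK.volume_pos
  have hyy := eq_smul_add_smul hd.ne' y
  set a := cross y w / cross u w
  set b := cross u y / cross u w
  rw [hyy] at hy ⊢
  have h1 := hF.abs_add_abs_le hK hs hy
  rw [inner_add_right, real_inner_smul_right, real_inner_smul_right,
    inner_dualVector_left hd.ne', inner_dualVector_right hd.ne']
  have h2 : a + σ * b ≤ |a| + |b| := by
    have := le_abs_self (σ * b)
    rw [abs_mul, hσ, one_mul] at this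
    linarith [le_abs_self a]
  calc _ = (a + σ * b) * (2 * cross u w / volume.real K) := by ring
    _ ≤ volume.real K / (2 * cross u w) * (2 * cross u w / volume.real K) := by
      gcongr; linarith
    _ = 1 := by field_simp

omit hK in
lemma abs_inner_left_le : |inner ℝ p w| ≤ 1 := by
  rw [abs_le]
  have := hF.left_support _ (IsConvexBody.neg_mem hs hF.right_mem)
  rw [inner_neg_right] at this
  exact ⟨by linarith, hF.left_support _ hF.right_mem⟩

omit hK in
lemma abs_inner_right_le : |inner ℝ q u| ≤ 1 := by
  rw [abs_le]
  have := hF.right_support _ (IsConvexBody.neg_mem hs hF.left_mem)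
  rw [inner_neg_right] at this
  exact ⟨by linarith, hF.right_support _ hF.left_mem⟩

/-- The four quarters into which the polar body is cut by the lines spanned by the vectors
`dualVector u w c (±c)` have area at least `2 / Vol(K)` each. -/
lemma area_polar_first :
    2 / volume.real K ≤ volume.real (polarBody K ∩
      openCone (dualVector u w (2 * cross u w / volume.real K) (-(2 * cross u w / volume.real K)))
        (dualVector u w (2 * cross u w / volume.real K) (2 * cross u w / volume.real K))) := by
  have hd := hF.cross_pos
  have hV : 0 < volume.real K := hK.volume_pos
  have hP := hK.polarBody hs
  have m1 := hF.dualVector_mem hK hs (σ := 1) (by simp)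
  have m2 := hF.dualVector_mem hK hs (σ := -1) (by simp)
  have hα := abs_le.1 (hF.abs_inner_left_le hs)
  have hp := eq_dualVector hd.ne' p
  rw [hF.inner_left] at hp
  rw [one_mul] at m1
  rw [neg_one_mul] at m2
  set c := 2 * cross u w / volume.real K with hc
  have hc0 : 0 < c := by positivity
  set α : ℝ := inner ℝ p w
  have hcr : cross (dualVector u w c (-c)) (dualVector u w c c) = 2 * c ^ 2 / cross u w := by
    rw [cross_dualVector hd.ne']; ring
  -- In dual coordinates `p = (1, α)` with `|α| ≤ 1` is a nonnegative combination of `(c, -c)` and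
  -- `(c, c)` whose coefficients sum to `1 / c`; hence the area bound does not depend on `α`.
  have := quadrilateral_le_volume hP.convex hP.isCompact.isClosed.measurableSet
    hP.volume_lt_top.ne (zero_mem_polarBody K) m2 m1 (by rw [hcr]; positivity)
    (a := (1 - α) / (2 * c)) (b := (1 + α) / (2 * c))
    (div_nonneg (by linarith) (by positivity)) (div_nonneg (by linarith) (by positivity)) (by
      rw [smul_dualVector_add]
      convert hF.left_support using 1
      rw [hp]
      congr 1
      · field_simp; ring
      · field_simp; ring)
  refine le_trans (le_of_eq ?_) this
  rw [hcr, hc]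
  field_simp
  ring

lemma area_polar_second :
    2 / volume.real K ≤ volume.real (polarBody K ∩
      openCone (dualVector u w (2 * cross u w / volume.real K) (2 * cross u w / volume.real K))
        (-dualVector u w (2 * cross u w / volume.real K)
          (-(2 * cross u w / volume.real K)))) := by
  have hd := hF.cross_pos
  have hV : 0 < volume.real K := hK.volume_pos
  have hP := hK.polarBody hs
  have m1 := hF.dualVector_mem hK hs (σ := 1) (by simp)
  have m2 := neg_mem_polarBody hs (hF.dualVector_mem hK hs (σ := -1) (by simp))
  have hα := abs_le.1 (hF.abs_inner_right_le hs)
  have hq := eq_dualVector hd.ne' q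
  rw [hF.inner_right] at hq
  rw [one_mul] at m1
  rw [neg_one_mul] at m2
  set c := 2 * cross u w / volume.real K with hc
  have hc0 : 0 < c := by positivity
  set α : ℝ := inner ℝ q u
  have hcr : cross (dualVector u w c c) (-dualVector u w c (-c)) = 2 * c ^ 2 / cross u w := by
    rw [neg_dualVector, cross_dualVector hd.ne']; ring
  have := quadrilateral_le_volume hP.convex hP.isCompact.isClosed.measurableSet
    hP.volume_lt_top.ne (zero_mem_polarBody K) m1 m2 (by rw [hcr]; positivity)
    (a := (1 + α) / (2 * c)) (b := (1 - α) / (2 * c))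
    (div_nonneg (by linarith) (by positivity)) (div_nonneg (by linarith) (by positivity)) (by
      rw [neg_dualVector, smul_dualVector_add]
      convert hF.right_support using 1
      rw [hq]
      congr 1
      · field_simp; ring
      · field_simp; ring)
  refine le_trans (le_of_eq ?_) this
  rw [hcr, hc]
  field_simp
  ring

/-- Two adjacent quarters of the polar body and their reflections contribute `2 / Vol(K)` each. -/
lemma eight_le : 8 ≤ volume.real K * volume.real (polarBody K) := by
  have hV : 0 < volume.real K := hK.volume_pos
  have hP := hK.polarBody hs
  have h1 := hF.area_polar_first hK hs
  have h2 := hF.area_polar_second hK hs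
  have h3 := two_mul_volume_openCone_add_le (neg_polarBody hs) hP.isCompact.isClosed.measurableSet
    hP.volume_lt_top.ne
    (dualVector u w (2 * cross u w / volume.real K) (-(2 * cross u w / volume.real K)))
    (dualVector u w (2 * cross u w / volume.real K) (2 * cross u w / volume.real K))
  have h4 : 8 / volume.real K ≤ volume.real (polarBody K) := by
    have e : 8 / volume.real K = 2 * (2 / volume.real K + 2 / volume.real K) := by ring
    rw [e]; linarith
  rw [div_le_iff₀ hV] at h4
  linarith

/-- In the case of equality the polar body is exactly filled by the triangles next to the
supporting functional `p`. -/
lemma area_eq (h : volume.real K * volume.real (polarBody K) = 8) :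
    volume.real (polarBody K ∩ openCone
        (dualVector u w (2 * cross u w / volume.real K) (-(2 * cross u w / volume.real K))) p) ≤
      cross (dualVector u w (2 * cross u w / volume.real K)
        (-(2 * cross u w / volume.real K))) p / 2 ∧
    volume.real (polarBody K ∩ openCone p
        (dualVector u w (2 * cross u w / volume.real K) (2 * cross u w / volume.real K))) ≤
      cross p (dualVector u w (2 * cross u w / volume.real K)
        (2 * cross u w / volume.real K)) / 2 := by
  have hd := hF.cross_pos
  have hV : 0 < volume.real K := hK.volume_pos
  have hP := hK.polarBody hs
  have h1 := hF.area_polar_first hK hs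
  have h2 := hF.area_polar_second hK hs
  have m1 := hF.dualVector_mem hK hs (σ := 1) (by simp)
  have m2 := hF.dualVector_mem hK hs (σ := -1) (by simp)
  have hα := abs_le.1 (hF.abs_inner_left_le hs)
  have hp := eq_dualVector hd.ne' p
  rw [hF.inner_left] at hp
  rw [one_mul] at m1
  rw [neg_one_mul] at m2
  have hPm := hP.isCompact.isClosed.measurableSet
  have h3 := two_mul_volume_openCone_add_le (neg_polarBody hs) hPm hP.volume_lt_top.ne
    (dualVector u w (2 * cross u w / volume.real K) (-(2 * cross u w / volume.real K)))
    (dualVector u w (2 * cross u w / volume.real K) (2 * cross u w / volume.real K))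
  have h4 : volume.real (polarBody K) = 8 / volume.real K := by
    field_simp; linarith
  have hcV : 2 * cross u w / volume.real K / cross u w = 2 / volume.real K := by field_simp
  set c := 2 * cross u w / volume.real K with hc
  have hc0 : 0 < c := by positivity
  set α : ℝ := inner ℝ p w
  have c1 : cross (dualVector u w c (-c)) p = (1 + α) * (2 / volume.real K) := by
    rw [hp, cross_dualVector hd.ne', ← hcV]; ring
  have c2 : cross p (dualVector u w c c) = (1 - α) * (2 / volume.real K) := by
    rw [hp, cross_dualVector hd.ne', ← hcV]; ring
  have hcr : cross (dualVector u w c (-c)) (dualVector u w c c) = 2 * c ^ 2 / cross u w := by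
    rw [cross_dualVector hd.ne']; ring
  have hv : 0 < 2 / volume.real K := by positivity
  have h5 := volume_openCone_add_le hPm hP.volume_lt_top.ne (u := dualVector u w c (-c)) (p := p)
    (w := dualVector u w c c) (by rw [hcr]; positivity) (by rw [c1]; nlinarith)
    (by rw [c2]; nlinarith)
  have t1 := triangle_le_volume hP.convex hP.volume_lt_top.ne (zero_mem_polarBody K) m2
    hF.left_support
  have t2 := triangle_le_volume hP.convex hP.volume_lt_top.ne (zero_mem_polarBody K)
    hF.left_support m1
  -- The four lower bounds add up to the whole area, so the quarter around `p` has area at most `2 /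
  -- Vol(K)`, which the two triangles at `p` already have together.
  have e : 8 / volume.real K = 4 * (2 / volume.real K) := by ring
  rw [h4, e] at h3
  rw [c1] at t1 ⊢
  rw [c2] at t2 ⊢
  constructor <;> linarith

/-- If equality holds and `u` has two distinct supporting functionals, then the area of `K` is at
most that of the parallelogram with vertices `±u`, `±w`. -/
lemma volume_le_of_two_supports (h : volume.real K * volume.real (polarBody K) = 8) {p' : E₂}
    (hp' : p' ∈ polarBody K) (hp'u : inner ℝ p' u = (1 : ℝ))
    (hlt : inner ℝ p w < (inner ℝ p' w : ℝ)) : volume.real K ≤ 2 * cross u w := by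
  by_contra! hV2
  have hd := hF.cross_pos
  have hV : 0 < volume.real K := hK.volume_pos
  have hP := hK.polarBody hs
  have m1 := hF.dualVector_mem hK hs (σ := 1) (by simp)
  have hp := eq_dualVector hd.ne' p
  have hq := eq_dualVector hd.ne' p'
  rw [hF.inner_left] at hp
  rw [hp'u] at hq
  rw [one_mul] at m1
  have hα' : inner ℝ p' w ≤ (1 : ℝ) := hp' _ hF.right_mem
  have hA := (hF.area_eq hK hs h).2
  have hc1 : 2 * cross u w / volume.real K < 1 := by rwa [div_lt_one hV]
  have hc0 : 0 < 2 * cross u w / volume.real K := by positivity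
  set c := 2 * cross u w / volume.real K with hc
  set α : ℝ := inner ℝ p w
  set α' : ℝ := inner ℝ p' w
  have c2 : cross p (dualVector u w c c) = (1 - α) * c / cross u w := by
    rw [hp, cross_dualVector hd.ne']; ring
  have hα1 : 0 < 1 - α := by linarith
  have hpos : 0 < cross p (dualVector u w c c) := by rw [c2]; positivity
  -- If `c < 1`, then `p'` lies in the cone of `p = (1, α)` and `(c, c)` strictly beyond the segment
  -- joining them: its coefficients sum to more than `1`. This contradicts that the triangle fills
  -- the cone.
  have := quadrilateral_le_volume hP.convex hP.isCompact.isClosed.measurableSet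
    hP.volume_lt_top.ne (zero_mem_polarBody K) hF.left_support m1 hpos
    (a := (1 - α') / (1 - α)) (b := (α' - α) / ((1 - α) * c))
    (div_nonneg (by linarith) hα1.le) (div_nonneg (by linarith) (by positivity)) (by
      convert hp' using 1
      rw [hp, smul_dualVector_add, hq]
      congr 1
      · field_simp; ring
      · field_simp; ring)
  have h1 : (1 - α') / (1 - α) + (α' - α) / ((1 - α) * c) ≤ 1 := by
    by_contra! hgt
    nlinarith
  have h2 : (1 - α') / (1 - α) + (α' - α) / ((1 - α) * c) =
      1 + (α' - α) * (1 - c) / ((1 - α) * c) := by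
    field_simp; ring
  have h3 : 0 < (α' - α) * (1 - c) / ((1 - α) * c) := by
    apply div_pos <;> apply mul_pos <;> linarith
  linarith

/-- In the case of equality the polar body is a triangle within some cone. -/
lemma exists_triangle_polar (h : volume.real K * volume.real (polarBody K) = 8) :
    ∃ v ∈ polarBody K, ∃ v' ∈ polarBody K, 0 < cross v v' ∧
      volume.real (polarBody K ∩ openCone v v') ≤ cross v v' / 2 := by
  have hd := hF.cross_pos
  have hV : 0 < volume.real K := hK.volume_pos
  have m1 := hF.dualVector_mem hK hs (σ := 1) (by simp)
  have m2 := hF.dualVector_mem hK hs (σ := -1) (by simp)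
  have hα := abs_le.1 (hF.abs_inner_left_le hs)
  have hp := eq_dualVector hd.ne' p
  rw [hF.inner_left] at hp
  rw [one_mul] at m1
  rw [neg_one_mul] at m2
  obtain ⟨h1, h2⟩ := hF.area_eq hK hs h
  set c := 2 * cross u w / volume.real K with hc
  have hc0 : 0 < c := by positivity
  rcases lt_or_ge (inner ℝ p w : ℝ) 1 with hlt | hge
  · refine ⟨_, hF.left_support, _, m1, ?_, h2⟩
    rw [hp, cross_dualVector hd.ne']
    apply div_pos _ hd
    nlinarith
  · refine ⟨_, m2, _, hF.left_support, ?_, h1⟩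
    rw [hp, cross_dualVector hd.ne']
    apply div_pos _ hd
    nlinarith

lemma eq_image_of_volume_le (h : volume.real K ≤ 2 * cross u w) :
    K = planeMap u w '' {x | |x 0| + |x 1| ≤ 1} := by
  have hd := hF.cross_pos
  apply Set.Subset.antisymm
  · intro y hy
    have hyy := eq_smul_add_smul hd.ne' y
    refine ⟨!₂[cross y w / cross u w, cross u y / cross u w], ?_, by
      rw [planeMap_apply]; simpa using hyy.symm⟩
    rw [hyy] at hy
    have := hF.abs_add_abs_le hK hs hy
    have h2 : volume.real K / (2 * cross u w) ≤ 1 := by rw [div_le_one (by positivity)]; exact h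
    simpa using this.trans h2
  · rintro _ ⟨x, hx, rfl⟩
    have key : ∀ {y : E₂} (_ : y ∈ K) (t : ℝ), ∃ z ∈ K, t • y = |t| • z := by
      intro y hy t
      rcases le_total 0 t with ht | ht
      · exact ⟨y, hy, by rw [abs_of_nonneg ht]⟩
      · exact ⟨-y, IsConvexBody.neg_mem hs hy, by rw [abs_of_nonpos ht]; module⟩
    obtain ⟨z, hz, hz'⟩ := key hF.left_mem (x 0)
    obtain ⟨z', hzm, hzz⟩ := key hF.right_mem (x 1)
    rw [planeMap_apply, hz', hzz]
    have hx' : |x 0| + |x 1| ≤ 1 := hx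
    have := hK.convex.sum_mem (t := Finset.univ) (w := ![1 - |x 0| - |x 1|, |x 0|, |x 1|])
      (z := ![0, z, z'])
      (by intro i _; fin_cases i <;> simp; linarith) (by simp [Fin.sum_univ_three]; ring)
      (by intro i _; fin_cases i <;> simp [hz, hzm, hK.zero_mem hs])
    simpa [Fin.sum_univ_three] using this

end IsBisectingFrame

/-- If the triangle `0`, `v`, `v'` fills the part of `L` in its cone, then the edge `v v'` lies
on the boundary of `L`. -/
lemma inner_le_one_of_volume_le {L : Set E₂} (hL : IsConvexBody L) (h0 : (0 : E₂) ∈ L)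
    {v v' : E₂} (hv : v ∈ L) (hv' : v' ∈ L) (hpos : 0 < cross v v')
    (hvol : volume.real (L ∩ openCone v v') ≤ cross v v' / 2) {y : E₂} (hy : y ∈ L) :
    inner ℝ y (dualVector v v' 1 1) ≤ (1 : ℝ) := by
  have hyy := eq_smul_add_smul hpos.ne' y
  set s := cross y v' / cross v v'
  set t := cross v y / cross v v'
  rw [hyy, real_inner_comm, inner_add_right, real_inner_smul_right, real_inner_smul_right,
    inner_dualVector_left hpos.ne', inner_dualVector_right hpos.ne']
  by_contra! hgt
  -- Since `y` may lie outside the cone, the midpoint of `v v'` is moved towards `y` by a step `e`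
  -- small enough to keep both coordinates nonnegative. Their sum still exceeds `1`, so the
  -- quadrilateral is larger than the triangle.
  set e : ℝ := 1 / (2 * (1 + |s| + |t|)) with he
  have hs := abs_nonneg s
  have ht := abs_nonneg t
  have he0 : 0 < e := by positivity
  have he2 : e * (1 + |s| + |t|) = 1 / 2 := by rw [he]; field_simp
  have h1 : -|s| ≤ s := neg_abs_le s
  have h2 : -|t| ≤ t := neg_abs_le t
  have h3 : e ≤ 1 / 2 := by nlinarith
  have hm := hL.convex (hL.convex hv hv' (by norm_num : (0 : ℝ) ≤ 1 / 2)
    (by norm_num : (0 : ℝ) ≤ 1 / 2) (by norm_num)) hy (by linarith : 0 ≤ 1 - e) he0.le (by ring)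
  have := quadrilateral_le_volume hL.convex hL.isCompact.isClosed.measurableSet
    hL.volume_lt_top.ne h0 hv hv' hpos (a := (1 - e) / 2 + e * s) (b := (1 - e) / 2 + e * t)
    (by nlinarith) (by nlinarith) (by
      convert hm using 1
      conv_rhs => rw [hyy]
      module)
  have h4 : 1 < (1 - e) / 2 + e * s + ((1 - e) / 2 + e * t) := by nlinarith
  nlinarith

theorem eight_le_mahlerVolume (hK : IsConvexBody K) (hs : -K = K) : 8 ≤ mahlerVolume K := by
  obtain ⟨β, hβ, hu, p, hp, hpu⟩ := exists_boundary_support hK hs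
    (w := !₂[(1 : ℝ), 0]) (by intro h; simpa using congrFun (congrArg WithLp.ofLp h) 0)
  obtain ⟨w, q, hF⟩ := exists_isBisectingFrame hK hs hu hp hpu
  exact hF.eight_le hK hs

theorem exists_eq_image_of_mahlerVolume_eq (hK : IsConvexBody K) (hs : -K = K)
    (h : mahlerVolume K = 8) :
    ∃ T : E₂ ≃ₗ[ℝ] E₂, K = T '' {x | |x 0| + |x 1| ≤ 1} := by
  suffices H : ∃ u w p q, IsBisectingFrame K u w p q ∧ volume.real K ≤ 2 * cross u w by
    obtain ⟨u, w, p, q, hF, hle⟩ := H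
    refine ⟨LinearEquiv.ofIsUnitDet (f := planeMap u w)
      (v := (EuclideanSpace.basisFun (Fin 2) ℝ).toBasis)
      (v' := (EuclideanSpace.basisFun (Fin 2) ℝ).toBasis) ?_, ?_⟩
    · rw [LinearMap.det_toMatrix, det_planeMap]
      exact hF.cross_pos.ne'.isUnit
    · exact hF.eq_image_of_volume_le hK hs hle
  obtain ⟨β, hβ, hu, p, hp, hpu⟩ := exists_boundary_support hK hs
    (w := !₂[(1 : ℝ), 0]) (by intro h; simpa using congrFun (congrArg WithLp.ofLp h) 0)
  obtain ⟨w, q, hF⟩ := exists_isBisectingFrame hK hs hu hp hpu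
  obtain ⟨v, hv, v', hv', hpos, hvol⟩ := hF.exists_triangle_polar hK hs h
  -- The edge `v v'` of the polar body corresponds to a point `u'` of `K` supported by both `v` and
  -- `v'`; the frame is rebuilt at this point.
  set u' := dualVector v v' 1 1 with hu'
  have hi : inner ℝ v u' = (1 : ℝ) := by
    rw [real_inner_comm]; exact inner_dualVector_left hpos.ne' _ _
  have hi' : inner ℝ v' u' = (1 : ℝ) := by
    rw [real_inner_comm]; exact inner_dualVector_right hpos.ne' _ _
  have hmem : u' ∈ K := by
    rw [← polarBody_polarBody hK.convex hK.isCompact.isClosed (hK.zero_mem hs)]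
    intro y hy
    rw [real_inner_comm]
    exact inner_le_one_of_volume_le (hK.polarBody hs) (zero_mem_polarBody K) hv hv' hpos hvol hy
  obtain ⟨w', q', hF'⟩ := exists_isBisectingFrame hK hs hmem hv hi
  -- The order decides which of the two supports plays the role of `p`. Equality would give `v =
  -- v'`, since both pair to `1` with `u'`.
  rcases lt_trichotomy (inner ℝ v w' : ℝ) (inner ℝ v' w') with hlt | heq | hgt
  · exact ⟨u', w', v, q', hF', hF'.volume_le_of_two_supports hK hs h hv' hi' hlt⟩
  · have e1 := eq_dualVector hF'.cross_pos.ne' v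
    have e2 := eq_dualVector hF'.cross_pos.ne' v'
    rw [hi, heq] at e1
    rw [hi', ← e1] at e2
    rw [e2, cross_same] at hpos
    exact absurd hpos (lt_irrefl _)
  · have hF'' : IsBisectingFrame K u' w' v' q' := { hF' with left_support := hv', inner_left := hi' }
    exact ⟨u', w', v', q', hF'', hF''.volume_le_of_two_supports hK hs h hv hi hgt⟩

end PlanarMahler

/-! ### Reduction of the body in space to a profile and a planar section -/

section SectionsBody

local notation "E₂" => EuclideanSpace ℝ (Fin 2)
local notation "E₃" => EuclideanSpace ℝ (Fin 3)

/-- Space as the product of the `X`-axis and the plane `YOZ`. -/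
def splitX : EuclideanSpace ℝ (Fin 3) ≃ₗ[ℝ] ℝ × EuclideanSpace ℝ (Fin 2) where
  toFun y := (y 0, !₂[y 1, y 2])
  invFun z := !₂[z.1, z.2 0, z.2 1]
  map_add' x y := by
    ext i
    · simp
    · fin_cases i <;> simp
  map_smul' r x := by
    ext i
    · simp
    · fin_cases i <;> simp
  left_inv y := by ext i; fin_cases i <;> simp
  right_inv z := by
    ext i
    · simp
    · fin_cases i <;> simp

lemma splitX_fst (y : E₃) : (splitX y).1 = y 0 := rfl

lemma splitX_snd (y : E₃) : (splitX y).2 = !₂[y 1, y 2] := rfl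

lemma inner_splitX (y z : E₃) :
    inner ℝ y z = (splitX y).1 * (splitX z).1 + inner ℝ (splitX y).2 (splitX z).2 := by
  simp [PiLp.inner_apply, Fin.sum_univ_two, Fin.sum_univ_three, splitX_fst, splitX_snd]
  ring

lemma measurePreserving_splitX : MeasurePreserving splitX volume volume := by
  have h1 := (PiLp.volume_preserving_ofLp (Fin 3))
  have h2 := volume_preserving_piFinSuccAbove (fun _ : Fin 3 => ℝ) 0
  have h3 := (MeasurePreserving.id (volume : Measure ℝ)).prod (PiLp.volume_preserving_toLp (Fin 2))
  have h := h3.comp (h2.comp h1)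
  have e : (splitX : E₃ → ℝ × E₂) = Prod.map id (WithLp.toLp 2) ∘
      (MeasurableEquiv.piFinSuccAbove (fun _ : Fin 3 => ℝ) 0) ∘ WithLp.ofLp := by
    funext y
    ext i
    · simp [splitX]
    · fin_cases i <;> simp [splitX, Fin.tail]
  rw [e]
  exact h

/-- The body with sections `ρ(|x|) • D` over `[-1, 1]`. -/
def sectionsBody (ρ : ℝ → ℝ) (D : Set (EuclideanSpace ℝ (Fin 2))) :
    Set (EuclideanSpace ℝ (Fin 3)) :=
  {y | |(splitX y).1| ≤ 1 ∧ (splitX y).2 ∈ ρ |(splitX y).1| • D}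

lemma volume_sectionsBody {ρ : ℝ → ℝ} (hρ : IsProfile ρ) {D : Set E₂}
    (hm : MeasurableSet (sectionsBody ρ D)) :
    volume.real (sectionsBody ρ D) = 2 * (∫ t in (0 : ℝ)..1, ρ t ^ 2) * volume.real D := by
  set S : Set (ℝ × E₂) := {z | |z.1| ≤ 1 ∧ z.2 ∈ ρ |z.1| • D} with hS
  have hSm : MeasurableSet S := by
    have : S = splitX.symm ⁻¹' sectionsBody ρ D := by
      ext z
      simp [sectionsBody, hS]
    rw [this]
    exact splitX.symm.toContinuousLinearEquiv.continuous.measurable hm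
  have h1 : volume (sectionsBody ρ D) = volume S :=
    measurePreserving_splitX.measure_preimage hSm.nullMeasurableSet
  -- The profile is controlled on `[0, 1]` only; clamping the argument makes it antitone on the
  -- line, hence measurable.
  set H : ℝ → ℝ := (Set.Iic (1 : ℝ)).indicator fun t => ρ (max 0 (min t 1)) ^ 2 with hH
  have hmem : ∀ t : ℝ, max 0 (min t 1) ∈ Set.Icc (0 : ℝ) 1 := fun t => by simp
  have hHm : Measurable H := by
    apply Measurable.indicator _ measurableSet_Iic
    apply Measurable.pow_const
    apply Antitone.measurable
    intro s t hst
    exact hρ.antitone (hmem s) (hmem t) (by gcongr)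
  have hHa : Measurable fun x : ℝ => H |x| := hHm.comp measurable_norm
  have hH0 : ∀ t, 0 ≤ H t := fun t => Set.indicator_nonneg (fun _ _ => sq_nonneg _) t
  have h2 : ∀ x : ℝ, volume (Prod.mk x ⁻¹' S) = ENNReal.ofReal (H |x|) * volume D := by
    intro x
    by_cases hx : |x| ≤ 1
    · have e : Prod.mk x ⁻¹' S = ρ |x| • D := by ext p; simp [hS, hx]
      have e2 : max 0 (min |x| 1) = |x| := by simp [hx]
      rw [e, Measure.addHaar_smul, hH, Set.indicator_of_mem (by exact hx), e2]
      simp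
    · have e : Prod.mk x ⁻¹' S = ∅ := by ext p; simp [hS, hx]
      rw [e, hH, Set.indicator_of_notMem (by exact hx)]
      simp
  have h3 : ∫ x, H |x| = 2 * ∫ t in (0 : ℝ)..1, ρ t ^ 2 := by
    rw [integral_comp_abs, intervalIntegral.integral_of_le zero_le_one, hH,
      setIntegral_indicator measurableSet_Iic, Set.Ioi_inter_Iic]
    congr 1
    apply setIntegral_congr_fun measurableSet_Ioc
    intro t ht
    have : max 0 (min t 1) = t := by simp [ht.1.le, ht.2]
    simp only [this]
  rw [Measure.real, h1, Measure.volume_eq_prod, Measure.prod_apply hSm]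
  simp only [h2]
  rw [lintegral_mul_const _ hHa.ennreal_ofReal, ENNReal.toReal_mul, ← h3,
    integral_eq_lintegral_of_nonneg_ae (Filter.Eventually.of_forall fun x => hH0 _)
    hHa.aestronglyMeasurable]
  rfl

/-- For `g = 0` the scaled polar is `{0}`, and `p` vanishes because `C` contains a ball around the
origin. -/
lemma mem_smul_polarBody {C : Set E₂} (hC : IsConvexBody C) (hs : -C = C) {p : E₂} {g : ℝ}
    (hg : 0 ≤ g) (h : ∀ c ∈ C, inner ℝ p c ≤ g) : p ∈ g • polarBody C := by
  rcases hg.eq_or_lt with rfl | hg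
  · obtain ⟨r, hr, hrC⟩ := hC.exists_ball hs
    have hp : p = 0 := by
      by_contra hp
      have hn : 0 < ‖p‖ := norm_pos_iff.2 hp
      have := h ((r * ‖p‖⁻¹) • p) (hrC (by
        rw [mem_closedBall_zero_iff, norm_smul, Real.norm_eq_abs, abs_of_pos (by positivity)]
        field_simp; rfl))
      rw [real_inner_smul_right, real_inner_self_eq_norm_sq] at this
      have : 0 < r * ‖p‖⁻¹ * ‖p‖ ^ 2 := by positivity
      linarith
    exact ⟨0, zero_mem_polarBody C, by simp [hp]⟩
  · refine ⟨g⁻¹ • p, fun c hc => ?_, by simp [smul_smul, hg.ne']⟩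
    rw [real_inner_smul_left, inv_mul_le_iff₀ hg, mul_one]
    exact h c hc

/-- Testing `(s, p)` against `(x, ρ|x| • c)` reads `s x + ρ|x| ⟨p, c⟩ ≤ 1`; choosing the sign of `x`
equal to that of `s`, this is the condition defining `dualProfile` with `r = ⟨p, c⟩`. -/
lemma polarBody_sectionsBody {ρ : ℝ → ℝ} (hρ : IsProfile ρ) {C : Set E₂} (hC : IsConvexBody C)
    (hs : -C = C) :
    polarBody (sectionsBody ρ C) = sectionsBody (dualProfile ρ) (polarBody C) := by
  have hmk : ∀ {x : ℝ} {c : E₂}, |x| ≤ 1 → c ∈ C →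
      splitX.symm (x, ρ |x| • c) ∈ sectionsBody ρ C := by
    intro x c hx hc
    simp only [sectionsBody, Set.mem_ofPred_eq, LinearEquiv.apply_symm_apply]
    exact ⟨hx, Set.smul_mem_smul_set hc⟩
  have habs : ∀ {x : ℝ}, |x| ≤ 1 → |x| ∈ Set.Icc (0 : ℝ) 1 := fun hx => ⟨abs_nonneg _, hx⟩
  ext y
  constructor
  · intro hy
    have hpt : ∀ {x : ℝ} {c : E₂}, |x| ≤ 1 → c ∈ C →
        (splitX y).1 * x + ρ |x| * inner ℝ (splitX y).2 c ≤ 1 := by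
      intro x c hx hc
      have := hy _ (hmk hx hc)
      rwa [inner_splitX, LinearEquiv.apply_symm_apply, real_inner_smul_right] at this
    have hy0 : |(splitX y).1| ≤ 1 := by
      have h1 := hpt (x := 1) (by simp) (hC.zero_mem hs)
      have h2 := hpt (x := -1) (by simp) (hC.zero_mem hs)
      rw [inner_zero_right] at h1 h2
      rw [abs_le]
      constructor <;> linarith
    refine ⟨hy0, mem_smul_polarBody hC hs (hρ.dual_nonneg (habs hy0)) fun c hc => ?_⟩
    rcases le_total (inner ℝ (splitX y).2 c : ℝ) 0 with hr | hr
    · exact hr.trans (hρ.dual_nonneg (habs hy0))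
    · apply hρ.le_dual hr
      intro x hx
      rcases le_total 0 (splitX y).1 with h0 | h0
      · have := hpt (x := x) (c := c) (by rw [abs_of_nonneg hx.1]; exact hx.2) hc
        rw [abs_of_nonneg hx.1] at this
        rw [abs_of_nonneg h0]
        linarith
      · have := hpt (x := -x) (c := c) (by rw [abs_neg, abs_of_nonneg hx.1]; exact hx.2) hc
        rw [abs_neg, abs_of_nonneg hx.1] at this
        rw [abs_of_nonpos h0]
        linarith
  · rintro ⟨hy0, q, hq, hqy⟩ z ⟨hz0, c, hc, hcz⟩
    simp only at hqy hcz
    rw [inner_splitX, ← hqy, ← hcz, real_inner_smul_left, real_inner_smul_right]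
    have h1 := hρ.dual_feasible (habs hy0) (habs hz0)
    have h2 := hq c hc
    have h3 : (splitX y).1 * (splitX z).1 ≤ |(splitX y).1| * |(splitX z).1| := by
      rw [← abs_mul]; exact le_abs_self _
    have h4 := mul_le_mul_of_nonneg_left h2
      (mul_nonneg (hρ.dual_nonneg (habs hy0)) (hρ.nonneg _ (habs hz0)))
    linarith

lemma mahlerVolume_sectionsBody {ρ : ℝ → ℝ} (hρ : IsProfile ρ) {C : Set E₂} (hC : IsConvexBody C)
    (hs : -C = C) (hcl : IsClosed (sectionsBody ρ C)) :
    mahlerVolume (sectionsBody ρ C) =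
      4 * ((∫ t in (0 : ℝ)..1, ρ t ^ 2) * ∫ t in (0 : ℝ)..1, dualProfile ρ t ^ 2) *
        mahlerVolume C := by
  have h1 := volume_sectionsBody hρ hcl.measurableSet
  have h2 := volume_sectionsBody hρ.dual (D := polarBody C) (by
    rw [← polarBody_sectionsBody hρ hC hs]; exact (isClosed_polarBody _).measurableSet)
  simp only [Measure.real] at h1 h2
  rw [mahlerVolume, mahlerVolume, polarBody_sectionsBody hρ hC hs, h1, h2]
  ring

/-- Concavity gives continuity in the interior, and the chord from `(0, 1)` to `(1, ρ 1)` bounds `ρ`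
from below at both ends. Only a downward jump at `1` remains, which closedness of the body excludes.
-/
lemma continuousOn_profile {ρ : ℝ → ℝ} (hρ : IsProfile ρ) {C : Set E₂} (hC : IsConvexBody C)
    (hs : -C = C) (hcl : IsClosed (sectionsBody ρ C)) : ContinuousOn ρ (Set.Icc 0 1) := by
  have hlow : ∀ x ∈ Set.Icc (0 : ℝ) 1, 1 - x + x * ρ 1 ≤ ρ x := by
    intro x hx
    have h3 := hρ.concave.2 (by simp : (0 : ℝ) ∈ Set.Icc (0 : ℝ) 1)
      (by simp : (1 : ℝ) ∈ Set.Icc (0 : ℝ) 1) (sub_nonneg.2 hx.2) hx.1 (by ring)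
    simpa [hρ.map_zero] using h3
  have hlim : ∀ a : ℝ, Filter.Tendsto (fun x : ℝ => 1 - x + x * ρ 1) (nhdsWithin a (Set.Icc 0 1))
      (nhds (1 - a + a * ρ 1)) := fun a =>
    (Continuous.tendsto (by fun_prop) a).mono_left nhdsWithin_le_nhds
  intro x hx
  rcases hx.1.eq_or_lt with rfl | h0
  · rw [ContinuousWithinAt, hρ.map_zero]
    refine tendsto_of_tendsto_of_tendsto_of_le_of_le' (by simpa using hlim 0) tendsto_const_nhds
      ?_ ?_
    · filter_upwards [self_mem_nhdsWithin] with t ht using hlow t ht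
    · filter_upwards [self_mem_nhdsWithin] with t ht using hρ.le_one ht
  rcases hx.2.eq_or_lt with rfl | h1
  · rw [ContinuousWithinAt, tendsto_order]
    constructor
    · intro b hb
      have := (tendsto_order.1 (hlim 1)).1 b (by linarith)
      filter_upwards [self_mem_nhdsWithin, this] with t ht htb using htb.trans_le (hlow t ht)
    · intro r hr
      obtain ⟨β, hβ, huC, q, hq, hqu⟩ := exists_boundary_support hC hs
        (w := !₂[(1 : ℝ), 0]) (by intro h; simpa using congrFun (congrArg WithLp.ofLp h) 0)
      set u := β • !₂[(1 : ℝ), 0]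
      have hr0 : 0 < r := (hρ.nonneg 1 (by simp)).trans_lt hr
      -- If `ρ ≥ r` on `[0, 1)`, the points `(t, r • u)` belong to the body, hence so does `(1, r •
      -- u)`; the functional `q` supporting `C` at `u` then gives `r ≤ ρ 1`.
      obtain ⟨x₁, hx₁, hx₁r⟩ : ∃ x₁ ∈ Set.Ico (0 : ℝ) 1, ρ x₁ < r := by
        by_contra! hall
        have hmem : ∀ t ∈ Set.Ico (0 : ℝ) 1, splitX.symm (t, r • u) ∈ sectionsBody ρ C := by
          intro t ht
          have hρt := hall t ht
          have hpos : 0 < ρ t := hr0.trans_le hρt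
          simp only [sectionsBody, Set.mem_ofPred_eq, LinearEquiv.apply_symm_apply,
            abs_of_nonneg ht.1]
          refine ⟨ht.2.le, (r / ρ t) • u, hC.smul_mem hs huC ?_, ?_⟩
          · rw [abs_of_pos (by positivity), div_le_one hpos]; exact hρt
          · simp only [smul_smul]; congr 1; field_simp
        have hc : Continuous fun t : ℝ => splitX.symm (t, r • u) :=
          splitX.symm.toContinuousLinearEquiv.continuous.comp (by fun_prop)
        have h1 : (1 : ℝ) ∈ closure (Set.Ico (0 : ℝ) 1) := by
          rw [closure_Ico zero_ne_one]; simp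
        have h2 : splitX.symm (1, r • u) ∈ sectionsBody ρ C :=
          closure_minimal hmem (hcl.preimage hc) h1
        simp only [sectionsBody, Set.mem_ofPred_eq,
          LinearEquiv.apply_symm_apply, abs_one] at h2
        obtain ⟨-, c, hcC, hcu⟩ := h2
        have h3 := congrArg (fun v => (inner ℝ q v : ℝ)) hcu
        simp only [real_inner_smul_right, hqu] at h3
        have h4 := hq c hcC
        nlinarith [hρ.nonneg 1 (by simp)]
      have hnb : Set.Ioi x₁ ∈ nhdsWithin (1 : ℝ) (Set.Icc 0 1) :=
        mem_nhdsWithin_of_mem_nhds (Ioi_mem_nhds hx₁.2)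
      filter_upwards [self_mem_nhdsWithin, hnb] with t ht ht'
      exact (hρ.antitone ⟨hx₁.1, hx₁.2.le⟩ ht (le_of_lt ht')).trans_lt hx₁r
  · have := (hρ.concave.subset Set.Ioo_subset_Icc_self (convex_Ioo 0 1)).continuousOn isOpen_Ioo
    exact (this.continuousAt (Ioo_mem_nhds h0 h1)).continuousWithinAt

/-- The linear map acting as multiplication by `a` on the `X`-axis and as `R` on the plane. -/
noncomputable def axisMap (a : ℝ) (ha : a ≠ 0)
    (R : EuclideanSpace ℝ (Fin 2) ≃ₗ[ℝ] EuclideanSpace ℝ (Fin 2)) :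
    EuclideanSpace ℝ (Fin 3) ≃ₗ[ℝ] EuclideanSpace ℝ (Fin 3) :=
  splitX ≪≫ₗ (LinearEquiv.smulOfNeZero ℝ ℝ a ha).prodCongr R ≪≫ₗ splitX.symm

lemma splitX_axisMap_symm {a : ℝ} (ha : a ≠ 0) (R : E₂ ≃ₗ[ℝ] E₂) (y : E₃) :
    splitX ((axisMap a ha R).symm y) = (a⁻¹ * (splitX y).1, R.symm (splitX y).2) := by
  simp only [axisMap, LinearEquiv.trans_symm, LinearEquiv.symm_symm, LinearEquiv.trans_apply,
    LinearEquiv.apply_symm_apply]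
  rfl

lemma mem_axisMap_image {a : ℝ} (ha : a ≠ 0) (R : E₂ ≃ₗ[ℝ] E₂) (S : Set E₃) (y : E₃) :
    y ∈ axisMap a ha R '' S ↔ splitX.symm (a⁻¹ * (splitX y).1, R.symm (splitX y).2) ∈ S := by
  rw [← splitX_axisMap_symm ha, LinearEquiv.symm_apply_apply, LinearEquiv.image_eq_preimage_symm]
  rfl

lemma mem_section_iff {x r : ℝ} {C : Set E₂} {y : E₃} :
    y ∈ r • (inPlaneYOZ '' C) + {x • unitX} ↔ (splitX y).1 = x ∧ (splitX y).2 ∈ r • C := by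
  rw [Set.mem_add]
  constructor
  · rintro ⟨_, ⟨_, ⟨c, hc, rfl⟩, rfl⟩, _, rfl, rfl⟩
    refine ⟨by simp [splitX_fst, inPlaneYOZ, unitX], c, hc, ?_⟩
    ext i
    fin_cases i <;> simp [splitX_snd, inPlaneYOZ, unitX]
  · rintro ⟨hx, c, hc, hcy⟩
    refine ⟨r • inPlaneYOZ c, Set.smul_mem_smul_set ⟨c, hc, rfl⟩, x • unitX, rfl, ?_⟩
    have h1 := congrFun (congrArg WithLp.ofLp hcy) 0
    have h2 := congrFun (congrArg WithLp.ofLp hcy) 1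
    simp [splitX_snd] at h1 h2
    ext i
    fin_cases i
    · simpa [inPlaneYOZ, unitX, splitX_fst] using hx.symm
    · simpa [inPlaneYOZ, unitX] using h1
    · simpa [inPlaneYOZ, unitX] using h2

/-- The axis is scaled by `a` and the plane by `f 0`, so that `ρ t = f (a t) / f 0`. -/
lemma exists_eq_axisMap_image {K : Set E₃} (hK : IsParallelSectionsHomothetyBody K) :
    ∃ (T : E₃ ≃ₗ[ℝ] E₃) (ρ : ℝ → ℝ) (C : Set E₂), IsProfile ρ ∧ IsConvexBody C ∧ -C = C ∧
      K = T '' sectionsBody ρ C := by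
  obtain ⟨hK, a, f, C, ha, hconc, heven, hnn, hC, hs, hKeq⟩ := hK
  have hmemK : ∀ y : E₃, y ∈ K ↔ |(splitX y).1| ≤ a ∧ (splitX y).2 ∈ f (splitX y).1 • C := by
    intro y
    rw [hKeq]
    simp only [Set.mem_iUnion, mem_section_iff, exists_prop]
    constructor
    · rintro ⟨x, hx, rfl, h⟩
      exact ⟨abs_le.2 hx, h⟩
    · rintro ⟨h1, h2⟩
      exact ⟨_, abs_le.1 h1, rfl, h2⟩
  -- For `y > 0`, `x` is a convex combination of `y` and `-y`, where the even function `f` takes the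
  -- same value.
  have hanti : ∀ x y, 0 ≤ x → x ≤ y → y ≤ a → f y ≤ f x := by
    intro x y hx hxy hya
    rcases hxy.eq_or_lt with rfl | hlt
    · exact le_rfl
    have hy : 0 < y := hx.trans_lt hlt
    have hym : y ∈ Set.Icc (-a) a := ⟨by linarith, hya⟩
    have hym' : -y ∈ Set.Icc (-a) a := ⟨by linarith, by linarith⟩
    have := hconc.2 hym hym' (div_nonneg (by linarith : 0 ≤ y + x) (by linarith : 0 ≤ 2 * y))
      (div_nonneg (by linarith : 0 ≤ y - x) (by linarith : 0 ≤ 2 * y)) (by field_simp; ring)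
    rw [heven y hym] at this
    simp only [smul_eq_mul] at this
    have e1 : (y + x) / (2 * y) * y + (y - x) / (2 * y) * -y = x := by field_simp; ring
    have e2 : (y + x) / (2 * y) * f y + (y - x) / (2 * y) * f y = f y := by field_simp; ring
    rwa [e1, e2] at this
  have habs : ∀ x, |x| ≤ a → f x = f |x| := by
    intro x hx
    rcases abs_choice x with h | h
    · rw [h]
    · rw [h, heven x (abs_le.1 hx)]
  -- Otherwise `f` vanishes and `K` lies on the axis, without interior.
  have hf0 : 0 < f 0 := by
    by_contra! hneg
    obtain ⟨x, hx⟩ := hK.nonempty_interior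
    have hz : ∀ y ∈ K, y 1 = 0 := by
      intro y hy
      obtain ⟨h1, c, hc, hcy⟩ := (hmemK y).1 hy
      have h2 : f (splitX y).1 = 0 := by
        apply le_antisymm _ (hnn _ (abs_le.1 h1))
        rw [habs _ h1]
        exact (hanti 0 _ le_rfl (abs_nonneg _) h1).trans hneg
      have h3 := congrFun (congrArg WithLp.ofLp hcy) 0
      simp [h2, splitX_snd] at h3
      exact h3.symm
    rw [mem_interior_iff_mem_nhds, Metric.nhds_basis_closedBall.mem_iff] at hx
    obtain ⟨r, hr, h⟩ := hx
    have h1 := hz x (h (by simpa using hr.le))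
    have h2 := hz (x + r • EuclideanSpace.single 1 1) (h (by
      rw [mem_closedBall_iff_norm, add_sub_cancel_left, norm_smul]
      simp [abs_of_pos hr]))
    simp [h1] at h2
    exact hr.ne' h2
  refine ⟨axisMap a ha.ne' (LinearEquiv.smulOfNeZero ℝ E₂ (f 0) hf0.ne'), fun t => f (a * t) / f 0,
    C, ⟨⟨convex_Icc _ _, ?_⟩, ?_, ?_, ?_⟩, hC, hs, ?_⟩
  · intro s hs t ht b c hb hc hbc
    have hmem : ∀ t ∈ Set.Icc (0 : ℝ) 1, a * t ∈ Set.Icc (-a) a := fun t ht =>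
      ⟨by nlinarith [ht.1], by nlinarith [ht.2]⟩
    have := hconc.2 (hmem s hs) (hmem t ht) hb hc hbc
    simp only [smul_eq_mul] at this ⊢
    have e : a * (b * s + c * t) = b * (a * s) + c * (a * t) := by ring
    rw [e, ← mul_div_assoc, ← mul_div_assoc, ← add_div]
    gcongr
  · intro s hs t ht hst
    have := hanti (a * s) (a * t) (mul_nonneg ha.le hs.1) (by gcongr) (by nlinarith [ht.2])
    simp only
    gcongr
  · simp [hf0.ne']
  · intro t ht
    exact div_nonneg (hnn _ ⟨by nlinarith [ht.1], by nlinarith [ht.2]⟩) hf0.le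
  · ext y
    rw [hmemK, mem_axisMap_image]
    simp only [sectionsBody, Set.mem_ofPred_eq, LinearEquiv.apply_symm_apply]
    have e1 : |a⁻¹ * (splitX y).1| = a⁻¹ * |(splitX y).1| := by
      rw [abs_mul, abs_of_pos (by positivity)]
    rw [e1, inv_mul_le_iff₀ ha, mul_one, mul_inv_cancel_left₀ ha.ne']
    refine and_congr_right fun hy => ?_
    rw [habs _ hy]
    constructor
    · rintro ⟨c, hc, hcy⟩
      refine ⟨c, hc, ?_⟩
      rw [LinearEquiv.eq_symm_apply, ← hcy]
      simp [smul_smul]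
      congr 1
      field_simp
    · rintro ⟨c, hc, hcy⟩
      refine ⟨c, hc, ?_⟩
      rw [LinearEquiv.eq_symm_apply] at hcy
      rw [← hcy]
      simp [smul_smul]
      congr 1
      field_simp

end SectionsBody

/-! ### The extremal bodies -/

section CubeAndOctahedron

local notation "E₂" => EuclideanSpace ℝ (Fin 2)
local notation "E₃" => EuclideanSpace ℝ (Fin 3)

lemma polarBody_stdCube : polarBody stdCube = stdOctahedron := by
  ext x
  have hin : ∀ y : E₃, inner ℝ x y = ∑ i, x i * y i := fun y => by
    simp [PiLp.inner_apply, Fin.sum_univ_three]; ring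
  constructor
  · intro hx
    -- The sign vector of `x` lies in the cube, and its inner product with `x` is the `ℓ¹` norm.
    have := hx (WithLp.toLp 2 fun i => SignType.sign (x i)) (fun i => by
      rcases lt_trichotomy (x i) 0 with h | h | h <;> simp [h])
    rw [hin] at this
    simpa [stdOctahedron] using this
  · intro hx y hy
    rw [hin]
    refine (Finset.sum_le_sum fun i _ => ?_).trans hx
    calc x i * y i ≤ |x i| * |y i| := by rw [← abs_mul]; exact le_abs_self _
      _ ≤ |x i| * 1 := by gcongr; exact hy i
      _ = |x i| := mul_one _

lemma isClosed_stdCube : IsClosed stdCube := by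
  have : stdCube = ⋂ i, {x : E₃ | |x i| ≤ 1} := by ext x; simp [stdCube]
  rw [this]
  exact isClosed_iInter fun i => isClosed_le (by fun_prop) continuous_const

lemma convex_stdCube : Convex ℝ stdCube := by
  intro x hx y hy a b ha hb hab i
  have h1 := abs_le.1 (hx i)
  have h2 := abs_le.1 (hy i)
  simp only [PiLp.add_apply, PiLp.smul_apply, smul_eq_mul]
  rw [abs_le]
  constructor <;> nlinarith

lemma polarBody_stdOctahedron : polarBody stdOctahedron = stdCube := by
  rw [← polarBody_stdCube]
  exact polarBody_polarBody convex_stdCube isClosed_stdCube (by intro i; simp)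

lemma volume_stdCube : volume stdCube = ENNReal.ofReal 8 := by
  have : stdCube = WithLp.ofLp ⁻¹' Set.Icc (fun _ : Fin 3 => (-1 : ℝ)) (fun _ => 1) := by
    ext x
    simp [stdCube, Pi.le_def, abs_le, forall_and]
  rw [this, (PiLp.volume_preserving_ofLp (Fin 3)).measure_preimage
    measurableSet_Icc.nullMeasurableSet, Real.volume_Icc_pi]
  rw [Fin.prod_const, ← ENNReal.ofReal_pow (by norm_num)]
  norm_num

lemma volume_stdOctahedron : volume stdOctahedron = ENNReal.ofReal (4 / 3) := by
  have h := volume_sum_rpow_le (Fin 3) (p := 1) le_rfl 1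
  have hm : MeasurableSet {x : Fin 3 → ℝ | (∑ i, |x i| ^ (1 : ℝ)) ^ (1 / (1 : ℝ)) ≤ 1} := by
    simp only [Real.rpow_one, div_one]
    exact (isClosed_le (by fun_prop) continuous_const).measurableSet
  have : stdOctahedron = WithLp.ofLp ⁻¹'
      {x : Fin 3 → ℝ | (∑ i, |x i| ^ (1 : ℝ)) ^ (1 / (1 : ℝ)) ≤ 1} := by
    ext x
    simp [stdOctahedron]
  rw [this, (PiLp.volume_preserving_ofLp (Fin 3)).measure_preimage hm.nullMeasurableSet, h]
  have g1 : Real.Gamma (1 / 1 + 1) = 1 := by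
    rw [show (1 / 1 + 1 : ℝ) = 2 by norm_num, Real.Gamma_two]
  have g2 : Real.Gamma ((Fintype.card (Fin 3) : ℝ) / 1 + 1) = 6 := by
    have := Real.Gamma_nat_eq_factorial 3
    simp only [Fintype.card_fin, div_one]
    rw [this]
    norm_num [Nat.factorial]
  rw [g1, g2]
  norm_num

lemma mahlerVolume_stdCube : mahlerVolume stdCube = 32 / 3 := by
  rw [mahlerVolume, polarBody_stdCube, volume_stdCube, volume_stdOctahedron,
    ENNReal.toReal_ofReal (by norm_num), ENNReal.toReal_ofReal (by norm_num)]
  norm_num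

lemma mahlerVolume_stdOctahedron : mahlerVolume stdOctahedron = 32 / 3 := by
  rw [mahlerVolume, polarBody_stdOctahedron, volume_stdCube, volume_stdOctahedron,
    ENNReal.toReal_ofReal (by norm_num), ENNReal.toReal_ofReal (by norm_num)]
  norm_num

lemma mem_smul_diamond_iff {r : ℝ} (hr : 0 ≤ r) (p : E₂) :
    p ∈ r • {x : E₂ | |x 0| + |x 1| ≤ 1} ↔ |p 0| + |p 1| ≤ r := by
  constructor
  · rintro ⟨x, hx, rfl⟩
    simp only [PiLp.smul_apply, smul_eq_mul, abs_mul, abs_of_nonneg hr, Set.mem_ofPred_eq] at hx ⊢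
    nlinarith
  · intro h
    rcases hr.eq_or_lt with rfl | hr
    · refine ⟨0, by simp, ?_⟩
      have h0 := abs_nonneg (p 0)
      have h1 := abs_nonneg (p 1)
      have e0 : p 0 = 0 := abs_eq_zero.1 (by linarith)
      have e1 : p 1 = 0 := abs_eq_zero.1 (by linarith)
      ext i
      fin_cases i <;> simp [e0, e1]
    · refine ⟨r⁻¹ • p, ?_, by simp [smul_smul, hr.ne']⟩
      simp only [PiLp.smul_apply, smul_eq_mul, abs_mul, Set.mem_ofPred_eq, abs_inv,
        abs_of_pos hr, ← mul_add]
      rwa [inv_mul_le_iff₀ hr, mul_one]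

/-- The linear map `(s, t) ↦ (s + t, s - t)` of the plane. -/
noncomputable def rotatePlane : EuclideanSpace ℝ (Fin 2) ≃ₗ[ℝ] EuclideanSpace ℝ (Fin 2) where
  toFun p := !₂[p 0 + p 1, p 0 - p 1]
  invFun p := !₂[(p 0 + p 1) / 2, (p 0 - p 1) / 2]
  map_add' x y := by ext i; fin_cases i <;> simp <;> ring
  map_smul' r x := by ext i; fin_cases i <;> simp <;> ring
  left_inv y := by ext i; fin_cases i <;> simp
  right_inv z := by ext i; fin_cases i <;> simp <;> ring

lemma abs_add_abs_le_one_iff (a b : ℝ) : |a| + |b| ≤ 1 ↔ |a + b| ≤ 1 ∧ |a - b| ≤ 1 := by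
  constructor
  · intro h
    exact ⟨(abs_add_le a b).trans h, (abs_sub a b).trans h⟩
  · rintro ⟨h1, h2⟩
    rw [abs_le] at h1 h2
    rcases abs_cases a with ⟨ha, _⟩ | ⟨ha, _⟩ <;> rcases abs_cases b with ⟨hb, _⟩ | ⟨hb, _⟩ <;>
      rw [ha, hb] <;> linarith

lemma mem_smul_image_iff (R : E₂ ≃ₗ[ℝ] E₂) (r : ℝ) (D : Set E₂) (p : E₂) :
    p ∈ r • (R '' D) ↔ R.symm p ∈ r • D := by
  constructor
  · rintro ⟨_, ⟨x, hx, rfl⟩, rfl⟩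
    exact ⟨x, hx, by simp⟩
  · rintro ⟨x, hx, h⟩
    refine ⟨R x, ⟨x, hx, rfl⟩, ?_⟩
    rw [LinearEquiv.eq_symm_apply] at h
    simpa using h

lemma sectionsBody_eq_octahedron {ρ : ℝ → ℝ} (hρ : ∀ x ∈ Set.Icc (0 : ℝ) 1, ρ x = 1 - x)
    (R : E₂ ≃ₗ[ℝ] E₂) :
    sectionsBody ρ (R '' {x | |x 0| + |x 1| ≤ 1}) =
      axisMap 1 one_ne_zero R '' stdOctahedron := by
  ext y
  rw [mem_axisMap_image]
  simp only [sectionsBody, Set.mem_ofPred_eq, mem_smul_image_iff, stdOctahedron,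
    Fin.sum_univ_three]
  have e : ∀ (x : ℝ) (p : E₂), |(splitX.symm (x, p)) 0| + |(splitX.symm (x, p)) 1| +
      |(splitX.symm (x, p)) 2| = |x| + |p 0| + |p 1| := fun x p => by simp [splitX]
  rw [e, inv_one, one_mul]
  constructor
  · rintro ⟨h1, h2⟩
    rw [hρ _ ⟨abs_nonneg _, h1⟩, mem_smul_diamond_iff (by linarith)] at h2
    linarith
  · intro h
    have h1 : |(splitX y).1| ≤ 1 := by
      linarith [abs_nonneg (R.symm (splitX y).2 0), abs_nonneg (R.symm (splitX y).2 1)]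
    refine ⟨h1, ?_⟩
    rw [hρ _ ⟨abs_nonneg _, h1⟩, mem_smul_diamond_iff (by linarith)]
    linarith

/-- The diamond `|s| + |t| ≤ 1` is the square `|s + t|, |s - t| ≤ 1`; `rotatePlane` exchanges the
two descriptions. -/
lemma sectionsBody_eq_cube {ρ : ℝ → ℝ} (hρ : ∀ x ∈ Set.Icc (0 : ℝ) 1, ρ x = 1)
    (R : E₂ ≃ₗ[ℝ] E₂) :
    sectionsBody ρ (R '' {x | |x 0| + |x 1| ≤ 1}) =
      axisMap 1 one_ne_zero (rotatePlane.symm ≪≫ₗ R) '' stdCube := by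
  ext y
  rw [mem_axisMap_image]
  have e : ∀ (x : ℝ) (p : E₂), splitX.symm (x, rotatePlane p) ∈ stdCube ↔
      |x| ≤ 1 ∧ |p 0| + |p 1| ≤ 1 := fun x p => by
    rw [abs_add_abs_le_one_iff]
    simp [stdCube, splitX, rotatePlane, Fin.forall_fin_succ]
  have e2 : (rotatePlane.symm ≪≫ₗ R).symm (splitX y).2 = rotatePlane (R.symm (splitX y).2) := rfl
  rw [e2, e, inv_one, one_mul]
  simp only [sectionsBody, Set.mem_ofPred_eq, mem_smul_image_iff]
  refine and_congr_right fun h1 => ?_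
  rw [hρ _ ⟨abs_nonneg _, h1⟩, mem_smul_diamond_iff zero_le_one]

end CubeAndOctahedron

/-! ### Assembly of the two inequalities -/

theorem theorem1p3 (K : Set (EuclideanSpace ℝ (Fin 3)))
    (hK : IsParallelSectionsHomothetyBody K) :
    (4 : ℝ) ^ 3 / (3 ! : ℝ) ≤ mahlerVolume K ∧
      (mahlerVolume K = (4 : ℝ) ^ 3 / (3 ! : ℝ) ↔
        IsLinearImage K stdCube ∨ IsLinearImage K stdOctahedron) := by
  have hconst : (4 : ℝ) ^ 3 / (3 ! : ℝ) = 32 / 3 := by norm_num [Nat.factorial]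
  rw [hconst]
  obtain ⟨T, ρ, C, hρ, hC, hs, hKT⟩ := exists_eq_axisMap_image hK
  have hcl : IsClosed (sectionsBody ρ C) := by
    have : sectionsBody ρ C = T ⁻¹' K := by rw [hKT, Set.preimage_image_eq _ T.injective]
    rw [this]
    exact hK.1.isCompact.isClosed.preimage T.toContinuousLinearEquiv.continuous
  have hM : mahlerVolume K = 4 * ((∫ t in (0 : ℝ)..1, ρ t ^ 2) *
      ∫ t in (0 : ℝ)..1, dualProfile ρ t ^ 2) * mahlerVolume C := by
    rw [hKT, mahlerVolume_image, mahlerVolume_sectionsBody hρ hC hs hcl]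
  have h1 := hρ.third_le_integral_sq_mul
  have h2 := eight_le_mahlerVolume hC hs
  refine ⟨by rw [hM]; nlinarith, fun h => ?_, ?_⟩
  · rw [hM] at h
    -- Both factors are at least their extremal values `1/3` and `8`, so equality of the product
    -- forces equality in each.
    have e1 : (∫ t in (0 : ℝ)..1, ρ t ^ 2) * (∫ t in (0 : ℝ)..1, dualProfile ρ t ^ 2) = 1 / 3 :=
      le_antisymm (by nlinarith) h1
    have e2 : mahlerVolume C = 8 := by rw [e1] at h; linarith
    obtain ⟨R, hR⟩ := exists_eq_image_of_mahlerVolume_eq hC hs e2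
    rcases hρ.eq_one_or_eq_sub (continuousOn_profile hρ hC hs hcl) e1 with hone | hsub
    · left
      exact ⟨axisMap 1 one_ne_zero (rotatePlane.symm ≪≫ₗ R) ≪≫ₗ T, by
        rw [hKT, hR, sectionsBody_eq_cube hone, Set.image_image]; rfl⟩
    · right
      exact ⟨axisMap 1 one_ne_zero R ≪≫ₗ T, by
        rw [hKT, hR, sectionsBody_eq_octahedron hsub, Set.image_image]; rfl⟩
  · rintro (⟨S, rfl⟩ | ⟨S, rfl⟩)
    · rw [mahlerVolume_image, mahlerVolume_stdCube]
    · rw [mahlerVolume_image, mahlerVolume_stdOctahedron]
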